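/- A sign pattern of order $n$ is an $n\times n$ matrix $\mathcal P=[p_{ij}]$ with entries in $\{+,-,0\}$, and its qualitative class $Q(\mathcal P)$ is the set of all real $n\times n$ matrices $A=[a_{ij}]$ with $\operatorname{sgn}(a_{ij})=p_{ij}$ for all $i,j$. The inertia of a real matrix is the triple consisting of the numbers of its eigenvalues, counted with algebraic multiplicity, having positive, negative and zero real part; $\mathcal P$ requires a unique inertia if all matrices in $Q(\mathcal P)$ have the same inertia. Let $\mathcal P$ be an irreducible sign pattern of order $n$ with zero diagonal that is combinatorially symmetric, that is, $p_{ij}\neq 0$ if and only if $p_{ji}\neq 0$. Let $G$ be its signed undirected graph: the vertices are $1,\dots,n$, there is an edge $\{i,j\}$ if and only if $p_{ij}\neq 0$, and this edge has the sign $p_{ij}p_{ji}$. Suppose that $G$ has exactly one cycle $\mathcal C$, of length $k$, and that the distance from $\mathcal C$ to every leaf of $G$ (a vertex of degree one) is even. A maximal signed path of $\mathcal C$ is a path with at least one edge, formed by consecutive edges of $\mathcal C$ all having the same sign, such that the edges of $\mathcal C$ that precede and follow it on $\mathcal C$ (possibly the same edge) have the opposite sign. Then $\mathcal P$ does not require a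 unique inertia if any one of the following holds: (i) $\mathcal C$ has an odd number of negative edges; (ii) every edge of $\mathcal C$ is negative; (iii) $k$ is even and $\mathcal C$ has a maximal signed path of odd length. -/

import Mathlib

/-- An `n × n` sign pattern: a matrix with entries in `{+, -, 0}`. -/
abbrev SignPattern (n : ℕ) : Type := Matrix (Fin n) (Fin n) SignType

namespace SignPattern

variable {n : ℕ}

/-- The qualitative class: all real matrices whose entries have the prescribed signs. -/
def qualitativeClass (P : SignPattern n) : Set (Matrix (Fin n) (Fin n) ℝ) :=
  {A | ∀ i j, SignType.sign (A i j) = P i j}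

/-- The multiset of complex eigenvalues of a real matrix, with algebraic multiplicity. -/
noncomputable def eigenvalues (A : Matrix (Fin n) (Fin n) ℝ) : Multiset ℂ :=
  (A.map (algebraMap ℝ ℂ)).charpoly.roots

/-- The inertia `(i₊, i₋, i₀)`: the numbers of eigenvalues, counted with algebraic multiplicity,
with positive, negative and zero real part. -/
noncomputable def inertia (A : Matrix (Fin n) (Fin n) ℝ) : ℕ × ℕ × ℕ :=
  ((eigenvalues A).countP (fun z => 0 < z.re),
    (eigenvalues A).countP (fun z => z.re < 0),
    (eigenvalues A).countP (fun z => z.re = 0))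

/-- All matrices in the qualitative class have the same inertia. -/
def RequiresUniqueInertia (P : SignPattern n) : Prop :=
  ∀ A ∈ P.qualitativeClass, ∀ B ∈ P.qualitativeClass, inertia A = inertia B

/-- Irreducibility: no simultaneous permutation of rows and columns brings the pattern to
block triangular form with two nonempty diagonal blocks, that is, no proper nonempty set `S` of
indices has only zero entries in the rows from `S` and the columns outside `S`. -/
def IsIrreducible (P : SignPattern n) : Prop :=
  ∀ S : Set (Fin n), S.Nonempty → S ≠ Set.univ → ∃ i ∈ S, ∃ j ∉ S, P i j ≠ 0

def IsCombinatoriallySymmetric (P : SignPattern n) : Prop :=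
  ∀ i j, P i j ≠ 0 ↔ P j i ≠ 0

def HasZeroDiagonal (P : SignPattern n) : Prop :=
  ∀ i, P i i = 0

/-- The underlying undirected graph. For a combinatorially symmetric pattern, distinct `i` and `j`
are adjacent if and only if `P i j ≠ 0`. -/
def graph (P : SignPattern n) : SimpleGraph (Fin n) :=
  SimpleGraph.fromRel (fun i j => P i j ≠ 0)

/-- The sign of the edge `{i, j}` is the product `P i j * P j i`. -/
def edgeSign (P : SignPattern n) : Sym2 (Fin n) → SignType :=
  Sym2.lift ⟨fun i j => P i j * P j i, fun _ _ => mul_comm _ _⟩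

/-- A leaf is a vertex of degree one. -/
def IsLeaf (P : SignPattern n) (v : Fin n) : Prop :=
  ∃! w, P.graph.Adj v w

/-- The distance from a vertex to a closed walk: the minimum of its distances to the vertices
of the walk. -/
noncomputable def distToCycle (P : SignPattern n) {u : Fin n} (C : P.graph.Walk u u)
    (v : Fin n) : ℕ :=
  sInf {d | ∃ w ∈ C.support, d = P.graph.dist v w}

/-- `C` is, as a subgraph, the only cycle of the graph: `C` is a cycle, and every cycle runs through
exactly the edges of `C` (so it differs from `C` by starting vertex and orientation only). -/
def IsUniqueCycle (P : SignPattern n) {u : Fin n} (C : P.graph.Walk u u) : Prop :=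
  C.IsCycle ∧ ∀ (v : Fin n) (D : P.graph.Walk v v), D.IsCycle →
    ∀ e, e ∈ D.edges ↔ e ∈ C.edges

/-- `Q` is a maximal signed path of sign `s` of the cycle `C`: a path with at least one edge that
consists of edges of `C` of sign `s`, such that each edge of `C` that follows `Q` at one of
its two ends has the opposite sign. -/
def IsMaximalSignedPath (P : SignPattern n) {u : Fin n} (C : P.graph.Walk u u) (s : SignType)
    {x y : Fin n} (Q : P.graph.Walk x y) : Prop :=
  s ≠ 0 ∧ Q.IsPath ∧ 0 < Q.length ∧ (∀ e ∈ Q.edges, e ∈ C.edges ∧ P.edgeSign e = s) ∧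
    ∀ e ∈ C.edges, e ∉ Q.edges → x ∈ e ∨ y ∈ e → P.edgeSign e = -s

end SignPattern

/-! Setting entries of a matrix in the class to zero gives a limit of matrices in the class, and a
small perturbation cannot lower the number of eigenvalues in an open set. Sparse matrices with
explicit spectra therefore give lower bounds for parts of the inertia. If the inertia were unique,
all these bounds would hold for one triple, whose sum is `n`.

Off the cycle the leaf condition lets every vertex at odd distance be matched to a vertex one step
further away. If `m` vertices off the cycle stay unmatched, every matrix of the class has the
eigenvalue zero with multiplicity at least `m` (`exists_tree_matching`).

For an odd number of negative edges, take the permutation that rotates the cycle and follows the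
matching elsewhere. It has `m` fixed points. It and its inverse give matrices whose coefficients of
`X ^ m` have opposite signs. Since `X ^ m` divides every characteristic polynomial, this sign is the
parity of the number of eigenvalues with positive real part (`not_requiresUniqueInertia_of_perm`).
An odd cycle with only negative edges is of this kind.

If the cycle is even, the graph is bipartite and every spectrum is symmetric about the imaginary
axis, so a simple imaginary eigenvalue stays on the axis under perturbation. Positive pairs of a
matching then bound the counts of the two open half-planes, and negative pairs bound the count of
the axis (`card_pos_add_card_neg_le`). A maximal signed path of odd length provides two matchings of
the cycle that violate the combined bound. If all edges are negative, a perfect matching puts as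
many eigenvalues on the axis as the cycle has vertices, while the directed cycle gives an eigenvalue
with positive real part; the total would exceed `n`. -/

open Filter Topology Polynomial

/-! ### Semicontinuity of eigenvalue counts. -/

section RootCounting

/-- Every multiset of cardinality `n` is enumerated by `Fin n`. -/
lemma Multiset.exists_fin_map_eq {α : Type*} {n : ℕ} (s : Multiset α) (hs : s.card = n) :
    ∃ z : Fin n → α, Finset.univ.val.map z = s := by
  subst hs
  induction s using Quotient.inductionOn with
  | h l => exact ⟨fun i => l.get (i.cast (by simp)), by
      rw [Fin.univ_val_map]; exact congrArg _ (List.ofFn_get l)⟩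

lemma Multiset.countP_map_univ {α : Type*} {n : ℕ} (z : Fin n → α) (p : α → Prop)
    [DecidablePred p] :
    (Finset.univ.val.map z).countP p = (Finset.univ.filter fun i => p (z i)).card := by
  rw [Multiset.countP_map, Finset.card_def, Finset.filter_val]

variable {n : ℕ}

lemma Matrix.card_roots_charpoly (M : Matrix (Fin n) (Fin n) ℂ) : M.charpoly.roots.card = n := by
  rw [IsAlgClosed.card_roots_eq_natDegree, M.charpoly_natDegree_eq_dim, Fintype.card_fin]

lemma Matrix.charpoly_eq_prod_of_roots {M : Matrix (Fin n) (Fin n) ℂ} {z : Fin n → ℂ}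
    (hz : Finset.univ.val.map z = M.charpoly.roots) : M.charpoly = ∏ i, (X - C (z i)) := by
  have h := (IsAlgClosed.splits M.charpoly).eq_prod_roots_of_monic M.charpoly_monic
  rw [← hz, Multiset.map_map] at h
  exact h

/-- Gershgorin's theorem gives a bound that is continuous in the matrix, as the compactness argument
for convergent matrices needs. -/
lemma Matrix.norm_le_of_isRoot_charpoly {M : Matrix (Fin n) (Fin n) ℂ} {z : ℂ}
    (hz : z ∈ M.charpoly.roots) : ‖z‖ ≤ ∑ i, ∑ j, ‖M i j‖ := by
  have hz' : M.charpoly.IsRoot z := (mem_roots'.1 hz).2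
  have h1 : Module.End.HasEigenvalue (Matrix.toLin' M) z := by
    rw [Module.End.hasEigenvalue_iff_isRoot_charpoly]
    simpa using hz'
  obtain ⟨k, hk⟩ := eigenvalue_mem_ball h1
  rw [mem_closedBall_iff_norm] at hk
  calc ‖z‖ = ‖(z - M k k) + M k k‖ := by ring_nf
    _ ≤ ‖z - M k k‖ + ‖M k k‖ := norm_add_le _ _
    _ ≤ ∑ j ∈ Finset.univ.erase k, ‖M k j‖ + ‖M k k‖ := by gcongr
    _ = ∑ j, ‖M k j‖ := Finset.sum_erase_add _ _ (Finset.mem_univ k)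
    _ ≤ ∑ i, ∑ j, ‖M i j‖ :=
      Finset.single_le_sum (f := fun i => ∑ j, ‖M i j‖)
        (fun i _ => Finset.sum_nonneg fun j _ => norm_nonneg _) (Finset.mem_univ k)

/-- The number of eigenvalues in an open set is lower semicontinuous. -/
theorem Matrix.eventually_countP_roots_le {ι : Type*} {l : Filter ι} [l.IsCountablyGenerated]
    {M₀ : Matrix (Fin n) (Fin n) ℂ} {M : ι → Matrix (Fin n) (Fin n) ℂ}
    (hM : Tendsto M l (𝓝 M₀)) (p : ℂ → Prop) [DecidablePred p] (hp : IsOpen {z | p z}) :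
    ∀ᶠ t in l, M₀.charpoly.roots.countP p ≤ (M t).charpoly.roots.countP p := by
  by_contra hcon
  rw [not_eventually] at hcon
  obtain ⟨t, ht, hlt⟩ := exists_seq_forall_of_frequently hcon
  have hMt : Tendsto (fun j => M (t j)) atTop (𝓝 M₀) := hM.comp ht
  -- The enumerations of the roots are arbitrary. They are bounded, so a subsequence converges, and
  -- comparing values of the characteristic polynomials shows that the limit enumerates the roots of
  -- `M₀`.
  choose z hz using fun j =>
    Multiset.exists_fin_map_eq (M (t j)).charpoly.roots (M (t j)).card_roots_charpoly
  have hbd : ∃ R, ∀ᶠ j in atTop, z j ∈ Metric.closedBall (0 : Fin n → ℂ) R := by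
    have hc : Continuous fun N : Matrix (Fin n) (Fin n) ℂ => ∑ i, ∑ j, ‖N i j‖ := by
      refine continuous_finsetSum _ fun i _ => continuous_finsetSum _ fun j _ => ?_
      exact (continuous_id.matrix_elem i j).norm
    have h2 := (hc.tendsto M₀).comp hMt
    have h3 := h2.eventually (gt_mem_nhds (lt_add_one _))
    refine ⟨∑ i, ∑ j, ‖M₀ i j‖ + 1, h3.mono fun j hj => ?_⟩
    rw [mem_closedBall_zero_iff, pi_norm_le_iff_of_nonneg (by positivity)]
    intro i
    refine (Matrix.norm_le_of_isRoot_charpoly (M := M (t j)) ?_).trans hj.le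
    rw [← hz j]
    exact Multiset.mem_map_of_mem _ (Finset.mem_univ_val i)
  obtain ⟨R, hR⟩ := hbd
  obtain ⟨a, -, φ, hφ, ha⟩ :=
    (isCompact_closedBall (0 : Fin n → ℂ) R).tendsto_subseq' hR.frequently
  have hroots : M₀.charpoly = ∏ i, (X - C (a i)) := by
    refine Polynomial.funext fun x => ?_
    have hc : Continuous fun N : Matrix (Fin n) (Fin n) ℂ => N.charpoly.eval x := by
      simp only [Matrix.eval_charpoly]
      exact (continuous_const.sub continuous_id).matrix_det
    have h1 : Tendsto (fun j => (M (t (φ j))).charpoly.eval x) atTop (𝓝 (M₀.charpoly.eval x)) :=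
      (hc.tendsto M₀).comp (hMt.comp hφ.tendsto_atTop)
    have h2 : Tendsto (fun j => ∏ i, (x - z (φ j) i)) atTop (𝓝 (∏ i, (x - a i))) :=
      tendsto_finsetProd _ fun i _ => tendsto_const_nhds.sub ((tendsto_pi_nhds.1 ha) i)
    have h3 : (fun j => (M (t (φ j))).charpoly.eval x) = fun j => ∏ i, (x - z (φ j) i) := by
      ext j
      rw [Matrix.charpoly_eq_prod_of_roots (hz (φ j)), eval_prod]
      simp
    rw [h3] at h1
    rw [tendsto_nhds_unique h1 h2, eval_prod]
    simp
  have hroots' : M₀.charpoly.roots = Finset.univ.val.map a := by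
    have : ∏ i, (X - C (a i)) = ((Finset.univ.val.map a).map fun x => X - C x).prod := by
      rw [Multiset.map_map]; rfl
    rw [hroots, this, roots_multiset_prod_X_sub_C]
  have hev : ∀ᶠ j in atTop, ∀ i, p (a i) → p (z (φ j) i) := by
    rw [eventually_all]
    intro i
    by_cases hi : p (a i)
    · exact ((tendsto_pi_nhds.1 ha i).eventually (hp.mem_nhds hi)).mono fun j hj _ => hj
    · exact Eventually.of_forall fun j h => absurd h hi
  obtain ⟨j, hj⟩ := hev.exists
  apply hlt (φ j)
  rw [← hz (φ j), hroots', Multiset.countP_map_univ, Multiset.countP_map_univ]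
  exact Finset.card_le_card fun i hi => by
    simp only [Finset.mem_filter, Finset.mem_univ, true_and] at hi ⊢
    exact hj i hi

/-- The number of eigenvalues in a closed set is upper semicontinuous. -/
theorem Matrix.eventually_countP_roots_ge {ι : Type*} {l : Filter ι} [l.IsCountablyGenerated]
    {M₀ : Matrix (Fin n) (Fin n) ℂ} {M : ι → Matrix (Fin n) (Fin n) ℂ}
    (hM : Tendsto M l (𝓝 M₀)) (p : ℂ → Prop) [DecidablePred p] (hp : IsClosed {z | p z}) :
    ∀ᶠ t in l, (M t).charpoly.roots.countP p ≤ M₀.charpoly.roots.countP p := by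
  filter_upwards [Matrix.eventually_countP_roots_le hM (fun z => ¬ p z) hp.isOpen_compl] with t ht
  have h1 := Multiset.card_eq_countP_add_countP p (M t).charpoly.roots
  have h2 := Multiset.card_eq_countP_add_countP p M₀.charpoly.roots
  rw [Matrix.card_roots_charpoly] at h1 h2
  omega

end RootCounting

/-! ### The lowest coefficient and the parity of the positive count. -/

section SignOfConstantTerm

lemma Complex.mul_conj_pos {z : ℂ} (hz : z ≠ 0) : ∃ r : ℝ, 0 < r ∧ z * starRingEnd ℂ z = r :=
  ⟨Complex.normSq z, Complex.normSq_pos.2 hz, Complex.mul_conj z⟩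

/-- For a multiset of nonzero complex numbers that is invariant under conjugation, the sign of
the product of the negatives is determined by the number of elements with positive real part. -/
theorem Multiset.prod_neg_of_map_conj_eq (s : Multiset ℂ) (hs : s.map (starRingEnd ℂ) = s)
    (h0 : (0 : ℂ) ∉ s) :
    ∃ r : ℝ, 0 < r ∧
      (s.map (fun z => -z)).prod = (-1) ^ (s.countP fun z => 0 < z.re) * (r : ℂ) := by
  induction hn : s.card using Nat.strong_induction_on generalizing s with
  | _ n ih =>
  rcases s.empty_or_exists_mem with rfl | ⟨z, hz⟩
  · exact ⟨1, one_pos, by simp⟩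
  obtain ⟨t, rfl⟩ := Multiset.exists_cons_of_mem hz
  have hz0 : z ≠ 0 := fun h => h0 (h ▸ hz)
  -- A real element is removed alone. A nonreal one is removed together with its conjugate; the pair
  -- contributes `normSq z > 0` to the product and 0 or 2 to the count.
  by_cases hre : starRingEnd ℂ z = z
  · have ht : t.map (starRingEnd ℂ) = t := by
      rw [Multiset.map_cons, hre] at hs
      exact (Multiset.cons_inj_right _).1 hs
    obtain ⟨r, hr, hprod⟩ := ih t.card (by rw [← hn]; simp) t ht
      (fun h => h0 (Multiset.mem_cons_of_mem h)) rfl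
    obtain ⟨x, rfl⟩ := Complex.conj_eq_iff_real.1 hre
    have hx0 : x ≠ 0 := by simpa using hz0
    rcases lt_or_gt_of_ne hx0 with hx | hx
    · refine ⟨-x * r, by nlinarith, ?_⟩
      rw [Multiset.map_cons, Multiset.prod_cons, hprod,
        Multiset.countP_cons_of_neg _ (by simpa using hx.le)]
      push_cast; ring
    · refine ⟨x * r, by positivity, ?_⟩
      rw [Multiset.map_cons, Multiset.prod_cons, hprod,
        Multiset.countP_cons_of_pos _ (by simpa using hx)]
      push_cast; ring
  · have hmem : starRingEnd ℂ z ∈ t := by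
      have : starRingEnd ℂ z ∈ z ::ₘ t := by
        rw [← hs]; exact Multiset.mem_map_of_mem _ (Multiset.mem_cons_self z t)
      exact (Multiset.mem_cons.1 this).resolve_left hre
    obtain ⟨t, rfl⟩ := Multiset.exists_cons_of_mem hmem
    have ht : t.map (starRingEnd ℂ) = t := by
      rw [Multiset.map_cons, Multiset.map_cons, Complex.conj_conj, Multiset.cons_swap] at hs
      exact (Multiset.cons_inj_right _).1 ((Multiset.cons_inj_right _).1 hs)
    obtain ⟨r, hr, hprod⟩ := ih t.card (by rw [← hn]; simp) t ht
      (fun h => h0 (Multiset.mem_cons_of_mem (Multiset.mem_cons_of_mem h))) rfl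
    obtain ⟨c, hc, hzc⟩ := Complex.mul_conj_pos hz0
    refine ⟨c * r, by positivity, ?_⟩
    have key : ((z ::ₘ starRingEnd ℂ z ::ₘ t).map (fun z => -z)).prod
        = (z * starRingEnd ℂ z) * (t.map (fun z => -z)).prod := by
      simp only [Multiset.map_cons, Multiset.prod_cons]; ring
    rw [key, hprod, hzc]
    by_cases hp : 0 < z.re
    · rw [Multiset.countP_cons_of_pos (p := fun z : ℂ => 0 < z.re) _ hp,
        Multiset.countP_cons_of_pos _ (by simpa using hp)]
      push_cast; ring
    · rw [Multiset.countP_cons_of_neg (p := fun z : ℂ => 0 < z.re) _ hp,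
        Multiset.countP_cons_of_neg _ (by simpa using hp)]
      push_cast; ring

lemma Polynomial.map_conj_roots (q : ℝ[X]) :
    (q.map (algebraMap ℝ ℂ)).roots.map (starRingEnd ℂ) = (q.map (algebraMap ℝ ℂ)).roots := by
  rw [← (IsAlgClosed.splits (q.map (algebraMap ℝ ℂ))).roots_map, Polynomial.map_map]
  congr 2
  ext x
  simp

/-- The sign of the lowest nonzero coefficient of a monic real polynomial is determined by the
number of its complex roots with positive real part. -/
theorem Polynomial.coeff_sign_of_X_pow_dvd {p : ℝ[X]} (hp : p.Monic) {m : ℕ} (hm : X ^ m ∣ p)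
    (h0 : p.coeff m ≠ 0) :
    ∃ r : ℝ, 0 < r ∧
      p.coeff m = (-1) ^ ((p.map (algebraMap ℝ ℂ)).roots.countP fun z => 0 < z.re) * r := by
  obtain ⟨q, rfl⟩ := hm
  have hq : q.Monic := (monic_X_pow m).of_mul_monic_left hp
  have hc : (X ^ m * q).coeff m = q.coeff 0 := by simpa using coeff_X_pow_mul q m 0
  rw [hc] at h0 ⊢
  have hQ : (q.map (algebraMap ℝ ℂ)) ≠ 0 := (hq.map _).ne_zero
  have hroots : ((X ^ m * q).map (algebraMap ℝ ℂ)).roots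
      = m • {0} + (q.map (algebraMap ℝ ℂ)).roots := by
    rw [Polynomial.map_mul, roots_mul (mul_ne_zero
      (by rw [Polynomial.map_pow, map_X]; exact pow_ne_zero _ X_ne_zero) hQ), Polynomial.map_pow, map_X,
      roots_X_pow]
  obtain ⟨r, hr, h⟩ := Multiset.prod_neg_of_map_conj_eq (q.map (algebraMap ℝ ℂ)).roots
    q.map_conj_roots (by
      intro h
      have := (mem_roots'.1 h).2
      rw [IsRoot, ← coeff_zero_eq_eval_zero, coeff_map] at this
      exact h0 (by simpa using this))
  refine ⟨r, hr, ?_⟩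
  have h2 : (q.map (algebraMap ℝ ℂ)).coeff 0
      = ((q.map (algebraMap ℝ ℂ)).roots.map (fun z => -z)).prod := by
    conv_lhs => rw [(IsAlgClosed.splits (q.map (algebraMap ℝ ℂ))).eq_prod_roots_of_monic (hq.map _)]
    rw [coeff_zero_eq_eval_zero, eval_multiset_prod, Multiset.map_map]
    simp
  rw [h, coeff_map] at h2
  rw [hroots, Multiset.countP_add, Multiset.countP_nsmul]
  have h3 : ({0} : Multiset ℂ).countP (fun z => 0 < z.re) = 0 :=
    Multiset.countP_eq_zero.2 (by simp)
  rw [h3, mul_zero, zero_add]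
  apply Complex.ofReal_injective
  push_cast
  exact h2

end SignOfConstantTerm

namespace SignPattern

variable {n : ℕ} (P : SignPattern n)

/-! ### Limits of matrices in the qualitative class. -/

section Weighted

lemma sign_mul_coe {a : ℝ} (ha : 0 < a) (s : SignType) : SignType.sign (a * (s : ℝ)) = s := by
  cases s <;> simp [ha]

/-- The matrix with entries of magnitudes `w` and the signs of `P`. -/
def weighted (w : Fin n → Fin n → ℝ) : Matrix (Fin n) (Fin n) ℝ :=
  Matrix.of fun i j => w i j * (P i j : ℝ)

lemma weighted_apply (w : Fin n → Fin n → ℝ) (i j : Fin n) :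
    P.weighted w i j = w i j * (P i j : ℝ) := rfl

lemma weighted_mem {w : Fin n → Fin n → ℝ} (hw : ∀ i j, 0 < w i j) :
    P.weighted w ∈ P.qualitativeClass := fun i j => sign_mul_coe (hw i j) _

lemma apply_eq_zero_of_mem {A : Matrix (Fin n) (Fin n) ℝ} (hA : A ∈ P.qualitativeClass)
    {i j : Fin n} (h : P i j = 0) : A i j = 0 := by
  rw [← sign_eq_zero_iff, hA i j, h]

lemma tendsto_weighted (w : Fin n → Fin n → ℝ) :
    Tendsto (fun ε : ℝ => P.weighted fun i j => w i j + ε) (𝓝[>] 0) (𝓝 (P.weighted w)) := by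
  have hc : Continuous fun ε : ℝ => P.weighted fun i j => w i j + ε := by
    refine continuous_matrix fun i j => ?_
    simp only [weighted_apply]
    fun_prop
  have := hc.tendsto 0
  simp only [add_zero] at this
  exact this.mono_left nhdsWithin_le_nhds

lemma tendsto_weighted_map (w : Fin n → Fin n → ℝ) :
    Tendsto (fun ε : ℝ => (P.weighted fun i j => w i j + ε).map (algebraMap ℝ ℂ)) (𝓝[>] 0)
      (𝓝 ((P.weighted w).map (algebraMap ℝ ℂ))) := by
  have hc : Continuous fun A : Matrix (Fin n) (Fin n) ℝ => A.map (algebraMap ℝ ℂ) :=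
    continuous_id.matrix_map (continuous_algebraMap ℝ ℂ)
  exact (hc.tendsto _).comp (P.tendsto_weighted w)

lemma exists_mem_of_eventually {w : Fin n → Fin n → ℝ} (hw : ∀ i j, 0 ≤ w i j)
    {p : Matrix (Fin n) (Fin n) ℝ → Prop}
    (h : ∀ᶠ ε in 𝓝[>] (0 : ℝ), p (P.weighted fun i j => w i j + ε)) :
    ∃ A ∈ P.qualitativeClass, p A := by
  obtain ⟨ε, hε, hpos⟩ := (h.and self_mem_nhdsWithin).exists
  exact ⟨_, P.weighted_mem fun i j => add_pos_of_nonneg_of_pos (hw i j) hpos, hε⟩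

/-- A limit of matrices of the qualitative class has at most as many eigenvalues in an open set as
some matrix of the class. -/
lemma exists_countP_le {w : Fin n → Fin n → ℝ} (hw : ∀ i j, 0 ≤ w i j) (p : ℂ → Prop)
    [DecidablePred p] (hp : IsOpen {z | p z}) :
    ∃ A ∈ P.qualitativeClass,
      (eigenvalues (P.weighted w)).countP p ≤ (eigenvalues A).countP p :=
  P.exists_mem_of_eventually hw
    (Matrix.eventually_countP_roots_le (P.tendsto_weighted_map w) p hp)

lemma charpoly_map_eq (A : Matrix (Fin n) (Fin n) ℝ) :
    (A.map (algebraMap ℝ ℂ)).charpoly = A.charpoly.map (algebraMap ℝ ℂ) :=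
  Matrix.charpoly_map A (algebraMap ℝ ℂ)

lemma card_eigenvalues (A : Matrix (Fin n) (Fin n) ℝ) : (eigenvalues A).card = n :=
  Matrix.card_roots_charpoly _

lemma inertia_sum (A : Matrix (Fin n) (Fin n) ℝ) :
    (inertia A).1 + (inertia A).2.1 + (inertia A).2.2 = n := by
  have key : ∀ s : Multiset ℂ, s.countP (fun z => 0 < z.re) + s.countP (fun z => z.re < 0) +
      s.countP (fun z => z.re = 0) = s.card := by
    intro s
    induction s using Multiset.induction_on with
    | empty => simp
    | cons a s ih =>
      simp only [Multiset.countP_cons, Multiset.card_cons]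
      rcases lt_trichotomy a.re 0 with h | h | h
      · rw [if_neg h.not_gt, if_pos h, if_neg h.ne]; omega
      · rw [if_neg h.not_gt, if_neg h.not_lt, if_pos h]; omega
      · rw [if_pos h, if_neg h.not_gt, if_neg h.ne']; omega
  exact (key _).trans (card_eigenvalues A)

end Weighted

/-! ### Parity obstruction from a permutation and its inverse. -/

section Permutation

/-- Each coefficient is a polynomial in the entries, read off from the universal characteristic
polynomial. -/
lemma continuous_charpoly_coeff (m : ℕ) :
    Continuous fun A : Matrix (Fin n) (Fin n) ℝ => A.charpoly.coeff m := by
  have h : ∀ A : Matrix (Fin n) (Fin n) ℝ, A.charpoly.coeff m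
      = MvPolynomial.eval₂ (RingHom.id ℝ) (fun ij : Fin n × Fin n => A ij.1 ij.2)
        ((Matrix.charpoly.univ ℝ (Fin n)).coeff m) := by
    intro A
    have := Matrix.charpoly.univ_map_eval₂Hom (Fin n) (RingHom.id ℝ)
      (fun ij : Fin n × Fin n => A ij.1 ij.2)
    have hA : A = Matrix.of (Function.curry fun ij : Fin n × Fin n => A ij.1 ij.2) := rfl
    conv_lhs => rw [hA]
    rw [← this, coeff_map]
    rfl
  simp only [h]
  change Continuous fun A : Matrix (Fin n) (Fin n) ℝ =>
    MvPolynomial.eval (fun ij : Fin n × Fin n => A ij.1 ij.2) _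
  exact (MvPolynomial.continuous_eval _).comp
    (continuous_pi fun ij => continuous_id.matrix_elem ij.1 ij.2)

/-- The magnitudes selecting the entries `(u, σ u)`. -/
def permWeight (σ : Equiv.Perm (Fin n)) (u v : Fin n) : ℝ := if σ u = v then 1 else 0

variable {P}

/-- The diagonal of `P` vanishes, so the row of a fixed point in the characteristic matrix is `X`
times a unit row. Once these factors are extracted, evaluation at `0` leaves a scaled permutation
matrix. -/
lemma coeff_charpoly_permWeight (hdiag : P.HasZeroDiagonal) (σ : Equiv.Perm (Fin n)) :
    (P.weighted (permWeight σ)).charpoly.coeff (Finset.univ.filter fun u => σ u = u).card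
      = (σ.sign : ℤ) * ∏ u, if σ u = u then 1 else -(P u (σ u) : ℝ) := by
  set A := P.weighted (permWeight σ) with hA
  have hentry : ∀ u v, A u v = if σ u = v then (P u v : ℝ) else 0 := by
    intro u v
    rw [hA, weighted_apply, permWeight]
    split_ifs <;> simp
  let N : Matrix (Fin n) (Fin n) ℝ[X] := Matrix.of fun u v =>
    if σ u = u then (if u = v then 1 else 0) else A.charmatrix u v
  have hfac : A.charmatrix = Matrix.diagonal (fun u => if σ u = u then (X : ℝ[X]) else 1) * N := by
    ext1 u v
    rw [Matrix.diagonal_mul]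
    simp only [N, Matrix.of_apply]
    by_cases hu : σ u = u
    · rw [if_pos hu, if_pos hu, Matrix.charmatrix_apply, hentry, hu]
      by_cases huv : u = v
      · subst huv
        simp [hdiag u]
      · simp [huv]
    · rw [if_neg hu, if_neg hu, one_mul]
  have hprod : ∏ u, (if σ u = u then (X : ℝ[X]) else 1)
      = X ^ (Finset.univ.filter fun u => σ u = u).card := by
    rw [← Finset.prod_filter, Finset.prod_const]
  have hN : N.map (evalRingHom 0) = Matrix.diagonal (fun u => if σ u = u then 1 else
      -(P u (σ u) : ℝ)) * σ.permMatrix ℝ := by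
    ext u v
    rw [Matrix.diagonal_mul]
    simp only [N, Matrix.of_apply, Matrix.map_apply, Equiv.Perm.permMatrix, PEquiv.toMatrix_apply,
      Equiv.toPEquiv_apply, Option.mem_some_iff]
    by_cases hu : σ u = u
    · rw [if_pos hu, if_pos hu, hu]
      by_cases huv : u = v <;> simp [huv]
    · rw [if_neg hu, if_neg hu, Matrix.charmatrix_apply, hentry]
      by_cases huv : σ u = v
      · subst huv
        simp [Ne.symm hu]
      · by_cases h : u = v
        · subst h
          simp [huv]
        · simp [huv, h]
  rw [Matrix.charpoly, hfac, Matrix.det_mul, Matrix.det_diagonal, hprod]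
  have h1 := coeff_X_pow_mul N.det (Finset.univ.filter fun u => σ u = u).card 0
  rw [zero_add] at h1
  rw [h1, coeff_zero_eq_eval_zero, ← coe_evalRingHom, RingHom.map_det]
  change (N.map (evalRingHom 0)).det = _
  rw [hN, Matrix.det_mul, Matrix.det_diagonal, Matrix.det_permutation, mul_comm]

/-- If the edges traversed by a permutation have negative product and all characteristic
polynomials are divisible by `X ^ m`, with `m` the number of fixed points, then the parity of the
number of eigenvalues with positive real part is not constant. -/
theorem not_requiresUniqueInertia_of_perm (hdiag : P.HasZeroDiagonal) (σ : Equiv.Perm (Fin n))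
    (hX : ∀ A ∈ P.qualitativeClass,
      (X : ℝ[X]) ^ (Finset.univ.filter fun u => σ u = u).card ∣ A.charpoly)
    (hprod : ∏ u, (if σ u = u then 1 else P u (σ u) * P (σ u) u) = -1) :
    ¬ P.RequiresUniqueInertia := by
  intro huniq
  set m := (Finset.univ.filter fun u => σ u = u).card with hm
  set c := (P.weighted (permWeight σ)).charpoly.coeff m with hc
  set c' := (P.weighted (permWeight σ⁻¹)).charpoly.coeff m with hc'
  have hm' : (Finset.univ.filter fun u => σ⁻¹ u = u).card = m := by
    rw [hm]
    refine congrArg _ (Finset.filter_congr fun u _ => ?_)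
    rw [Equiv.Perm.inv_eq_iff_eq, eq_comm]
  -- The inverse traverses the same edges backwards and has the same signature, so the product of
  -- the two coefficients is the product of the edge signs along `σ`.
  have hcc : c * c' = -1 := by
    have h1 : c' = (σ⁻¹.sign : ℤ) * ∏ u, if σ⁻¹ u = u then 1 else -(P u (σ⁻¹ u) : ℝ) := by
      rw [hc', ← hm', coeff_charpoly_permWeight hdiag]
    have h2 : ∏ u, (if σ⁻¹ u = u then 1 else -(P u (σ⁻¹ u) : ℝ))
        = ∏ u, if σ u = u then 1 else -(P (σ u) u : ℝ) := by
      rw [← Equiv.prod_comp σ]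
      refine Finset.prod_congr rfl fun u _ => ?_
      simp [eq_comm]
    rw [h1, h2, hc, hm, coeff_charpoly_permWeight hdiag, Equiv.Perm.sign_inv]
    have h3 : (∏ u, if σ u = u then 1 else -(P u (σ u) : ℝ)) *
        (∏ u, if σ u = u then 1 else -(P (σ u) u : ℝ)) = -1 := by
      rw [← Finset.prod_mul_distrib]
      have := congrArg (SignType.castHom (α := ℝ)) hprod
      rw [map_prod] at this
      rw [show (-1 : ℝ) = SignType.castHom (α := ℝ) (-1) by simp, ← this]
      refine Finset.prod_congr rfl fun u _ => ?_
      split_ifs <;> simp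
    have h4 : ((σ.sign : ℤ) : ℝ) * ((σ.sign : ℤ) : ℝ) = 1 := by
      rcases Int.units_eq_one_or σ.sign with h | h <;> simp [h]
    linear_combination (((σ.sign : ℤ) : ℝ) * ((σ.sign : ℤ) : ℝ)) * h3 - h4
  have key : ∀ τ : Equiv.Perm (Fin n), (P.weighted (permWeight τ)).charpoly.coeff m ≠ 0 →
      ∃ A ∈ P.qualitativeClass,
        0 < A.charpoly.coeff m * (P.weighted (permWeight τ)).charpoly.coeff m := by
    intro τ h0
    refine P.exists_mem_of_eventually (w := permWeight τ)
      (fun i j => by rw [permWeight]; split_ifs <;> norm_num) ?_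
    have ht := ((continuous_charpoly_coeff m).tendsto _).comp (P.tendsto_weighted (permWeight τ))
    exact (ht.mul_const _).eventually (lt_mem_nhds (mul_self_pos.2 h0))
  obtain ⟨A, hA, hAc⟩ := key σ (by rw [← hc]; intro h; simp [h] at hcc)
  obtain ⟨B, hB, hBc⟩ := key σ⁻¹ (by rw [← hc']; intro h; simp [h] at hcc)
  rw [← hc] at hAc
  rw [← hc'] at hBc
  have hsign : A.charpoly.coeff m * B.charpoly.coeff m < 0 := by
    have := mul_pos hAc hBc
    nlinarith
  obtain ⟨r, hr, hrA⟩ := coeff_sign_of_X_pow_dvd A.charpoly_monic (hX A hA)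
    (by intro h; simp [h] at hsign)
  obtain ⟨t, ht, htB⟩ := coeff_sign_of_X_pow_dvd B.charpoly_monic (hX B hB)
    (by intro h; simp [h] at hsign)
  have hin := congrArg Prod.fst (huniq A hA B hB)
  simp only [inertia, eigenvalues, charpoly_map_eq] at hin
  rw [hrA, htB, hin] at hsign
  have hsq : ∀ k : ℕ, ((-1 : ℝ) ^ k) * (-1) ^ k = 1 := fun k => by
    rw [← mul_pow]; norm_num
  have := mul_pos hr ht
  have h5 := hsq ((B.charpoly.map (algebraMap ℝ ℂ)).roots.countP fun z => 0 < z.re)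
  nlinarith

end Permutation

end SignPattern

/-! ### Spectra symmetric about the imaginary axis. -/

section Reflection

variable {n : ℕ}

lemma Matrix.roots_charpoly_neg (M : Matrix (Fin n) (Fin n) ℂ) :
    (-M).charpoly.roots = M.charpoly.roots.map fun z => -z := by
  obtain ⟨z, hz⟩ := Multiset.exists_fin_map_eq M.charpoly.roots M.card_roots_charpoly
  have h : (-M).charpoly = ((Finset.univ.val.map fun i => -z i).map fun x => X - C x).prod := by
    refine Polynomial.funext fun x => ?_
    have h1 : Matrix.scalar (Fin n) x - -M = -(Matrix.scalar (Fin n) (-x) - M) := by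
      rw [map_neg]; abel
    rw [Matrix.eval_charpoly, h1, Matrix.det_neg, ← Matrix.eval_charpoly,
      Matrix.charpoly_eq_prod_of_roots hz, Multiset.map_map, eval_prod]
    change _ = eval x (∏ i, (X - C (-z i)))
    rw [eval_prod, ← Finset.card_univ, ← Finset.prod_const, ← Finset.prod_mul_distrib]
    refine Finset.prod_congr rfl fun i _ => ?_
    simp
    ring
  rw [h, roots_multiset_prod_X_sub_C, ← hz, Multiset.map_map]
  rfl

/-- A matrix supported on the edges of a bipartite graph is similar to its negative. -/
lemma Matrix.charpoly_neg_of_bipartite {R : Type*} [CommRing R] (χ : Fin n → Bool)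
    {M : Matrix (Fin n) (Fin n) R} (hM : ∀ u v, χ u = χ v → M u v = 0) :
    (-M).charpoly = M.charpoly := by
  let s : Fin n → R := fun u => if χ u then 1 else -1
  have hs : ∀ u, s u * s u = 1 := fun u => by simp only [s]; split_ifs <;> simp
  have h1 : -M = (Matrix.diagonal s * M) * Matrix.diagonal s := by
    ext u v
    rw [Matrix.mul_diagonal, Matrix.diagonal_mul, Matrix.neg_apply]
    by_cases h : χ u = χ v
    · rw [hM u v h]; simp
    · cases hu : χ u <;> cases hv : χ v <;> simp_all [s]
  rw [h1, Matrix.charpoly_mul_comm, ← Matrix.mul_assoc, Matrix.diagonal_mul_diagonal]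
  simp [hs]

/-- An isolated point of a multiset that is symmetric about the imaginary axis lies on that axis
if it lies close to it. -/
lemma Multiset.exists_mem_imaginary (R : Multiset ℂ)
    (hR : R.map (fun z => -starRingEnd ℂ z) = R) {c : ℂ} (hc : c.re = 0) {δ : ℝ}
    (h1 : 1 ≤ R.countP fun z => ‖z - c‖ < δ) (h2 : R.countP (fun z => ‖z - c‖ ≤ δ) ≤ 1) :
    ∃ z ∈ R, z.re = 0 ∧ ‖z - c‖ < δ := by
  obtain ⟨z, hz, hzc⟩ := Multiset.countP_pos.1 h1
  refine ⟨z, hz, ?_, hzc⟩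
  -- Off the axis, `z` and its mirror image are distinct and equally far from `c`, so the disc would
  -- contain two elements.
  by_contra hre
  have hz' : -starRingEnd ℂ z ∈ R := by
    rw [← hR]; exact Multiset.mem_map_of_mem (fun z => -starRingEnd ℂ z) hz
  have hc' : c = -starRingEnd ℂ c := by
    apply Complex.ext <;> simp [hc]
  have hdist : ‖-starRingEnd ℂ z - c‖ < δ := by
    have : -starRingEnd ℂ z - c = -starRingEnd ℂ (z - c) := by
      conv_lhs => rw [hc']
      rw [map_sub]; ring
    rw [this, norm_neg, RCLike.norm_conj]
    exact hzc
  have hne : z ≠ -starRingEnd ℂ z := by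
    intro h
    have := congrArg Complex.re h
    simp at this
    exact hre (by linarith)
  have hle : ({z, -starRingEnd ℂ z} : Multiset ℂ) ≤ R := by
    refine (Multiset.le_iff_subset (by simpa using hne)).2 ?_
    intro a ha
    simp only [Multiset.insert_eq_cons, Multiset.mem_cons, Multiset.mem_singleton] at ha
    rcases ha with rfl | rfl <;> assumption
  have h3 := Multiset.countP_le_of_le (fun z => ‖z - c‖ ≤ δ) hle
  have h4 : ({z, -starRingEnd ℂ z} : Multiset ℂ).countP (fun z => ‖z - c‖ ≤ δ) = 2 := by
    rw [Multiset.countP_eq_card.2]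
    · simp
    · intro a ha
      simp only [Multiset.insert_eq_cons, Multiset.mem_cons, Multiset.mem_singleton] at ha
      rcases ha with rfl | rfl
      exacts [hzc.le, hdist.le]
  omega

lemma Multiset.card_add_le_countP_imaginary {ι : Type*} (R : Multiset ℂ) {m : ℕ}
    (hm : m ≤ R.count 0) (S : Finset ι) (ζ : ι → ℂ) (hinj : Set.InjOn ζ S)
    (hmem : ∀ i ∈ S, ζ i ∈ R) (hre : ∀ i ∈ S, (ζ i).re = 0) (h0 : ∀ i ∈ S, ζ i ≠ 0) :
    S.card + m ≤ R.countP fun z => z.re = 0 := by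
  have hle : Multiset.replicate m 0 + (S.image ζ).val ≤ R := by
    rw [Multiset.le_iff_count]
    intro a
    rw [Multiset.count_add, Multiset.count_replicate]
    by_cases ha : a ∈ (S.image ζ).val
    · rw [Multiset.count_eq_one_of_mem (S.image ζ).nodup ha]
      obtain ⟨i, hi, rfl⟩ := Finset.mem_image.1 ha
      rw [if_neg (h0 i hi).symm]
      exact Multiset.one_le_count_iff_mem.2 (hmem i hi)
    · rw [Multiset.count_eq_zero_of_notMem ha]
      split_ifs with h
      · subst h; exact hm
      · exact Nat.zero_le _
  refine le_trans (le_of_eq ?_) (Multiset.countP_le_of_le (fun z : ℂ => z.re = 0) hle)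
  rw [Multiset.countP_eq_card.2]
  · rw [Multiset.card_add, Multiset.card_replicate, Finset.card_val,
      Finset.card_image_of_injOn hinj, add_comm]
  · intro a ha
    rcases Multiset.mem_add.1 ha with h | h
    · rw [Multiset.eq_of_mem_replicate h]; simp
    · obtain ⟨i, hi, rfl⟩ := Finset.mem_image.1 h
      exact hre i hi

end Reflection

namespace SignPattern

variable {n : ℕ} (P : SignPattern n)

/-! ### Inertia bounds from matchings. -/

section Matching

/-- A magnitude attached to the pairs of an involution, different for different pairs. -/
def pairWeight (σ : Fin n → Fin n) (u : Fin n) : ℤ := min u.val (σ u).val + 1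

lemma pairWeight_pos (σ : Fin n → Fin n) (u : Fin n) : 0 < pairWeight σ u := by
  unfold pairWeight; positivity

variable {σ : Fin n → Fin n} (hσ : Function.Involutive σ)
include hσ

lemma pairWeight_apply (u : Fin n) : pairWeight σ (σ u) = pairWeight σ u := by
  rw [pairWeight, pairWeight, hσ u, min_comm]

lemma eq_or_eq_of_pairWeight_eq {u v : Fin n} (h : pairWeight σ v = pairWeight σ u) :
    v = u ∨ v = σ u := by
  unfold pairWeight at h
  have h' : min v.val (σ v).val = min u.val (σ u).val := by omega
  rcases min_choice v.val (σ v).val with h1 | h1 <;> rcases min_choice u.val (σ u).val with h2 | h2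
    <;> rw [h1, h2] at h' <;> have h3 := Fin.ext h'
  · exact Or.inl h3
  · exact Or.inr h3
  · right; rw [← h3, hσ]
  · left; exact hσ.injective h3

omit hσ

/-- The magnitudes `pairWeight` on the pairs of an involution, and zero elsewhere. -/
def matchingWeight (σ : Fin n → Fin n) (u v : Fin n) : ℝ :=
  if σ u = v then pairWeight σ u else 0

lemma matchingWeight_nonneg (σ : Fin n → Fin n) (u v : Fin n) : 0 ≤ matchingWeight σ u v := by
  unfold matchingWeight
  split_ifs
  · exact_mod_cast (pairWeight_pos σ u).le
  · exact le_rfl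

/-- One of the two eigenvalues belonging to the pair of `u`. -/
noncomputable def pairRoot (σ : Fin n → Fin n) (u : Fin n) : ℂ :=
  if P u (σ u) * P (σ u) u = 1 then (pairWeight σ u : ℂ)
  else if P u (σ u) * P (σ u) u = -1 then (pairWeight σ u : ℂ) * Complex.I else 0

/-- The right-hand side is the diagonal entry at `u` of the square of the matching matrix. Only this
square enters the characteristic polynomial. -/
lemma pairRoot_mul_self (σ : Fin n → Fin n) (u : Fin n) :
    P.pairRoot σ u * P.pairRoot σ u
      = (pairWeight σ u : ℂ) ^ 2 * ((P u (σ u) * P (σ u) u : SignType) : ℂ) := by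
  unfold pairRoot
  generalize P u (σ u) * P (σ u) u = s
  cases s
  · simp
  · have h : SignType.neg = -1 := rfl
    rw [h, if_neg (by decide), if_pos rfl]
    have h1 : ((-1 : SignType) : ℂ) = -1 := by simp
    rw [h1]
    linear_combination (pairWeight σ u : ℂ) ^ 2 * Complex.I_mul_I
  · simp [sq]

variable {χ : Fin n → Bool} (hχ : ∀ u v, χ u = χ v → P u v = 0)

include hσ hχ in
/-- The characteristic polynomial of the matrix of a matching, squared. -/
lemma charpoly_matchingWeight_mul_self :
    ((P.weighted (matchingWeight σ)).map (algebraMap ℝ ℂ)).charpoly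
      * ((P.weighted (matchingWeight σ)).map (algebraMap ℝ ℂ)).charpoly
      = ∏ u, ((X - C (P.pairRoot σ u)) * (X - C (-P.pairRoot σ u))) := by
  set M := (P.weighted (matchingWeight σ)).map (algebraMap ℝ ℂ) with hM
  have hentry : ∀ u v, M u v = if σ u = v then (pairWeight σ u : ℂ) * (P u v : ℂ) else 0 := by
    intro u v
    rw [hM, Matrix.map_apply, weighted_apply, matchingWeight]
    split_ifs
    · cases P u v <;> simp
    · simp
  -- Bipartiteness turns the squared polynomial into `det (x + M) * det (x - M)`, and the product of
  -- these matrices is diagonal because `M * M` is. Squaring avoids the choice of one vertex from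
  -- each pair.
  have hneg : (-M).charpoly = M.charpoly := by
    refine Matrix.charpoly_neg_of_bipartite χ fun u v huv => ?_
    rw [hentry, hχ u v huv]; simp
  have hsq : M * M = Matrix.diagonal fun u => P.pairRoot σ u * P.pairRoot σ u := by
    ext u v
    rw [Matrix.mul_apply, Finset.sum_eq_single (σ u)]
    · rw [hentry, hentry, if_pos rfl, hσ u, pairWeight_apply hσ, Matrix.diagonal_apply]
      split_ifs with huv
      · subst huv
        rw [pairRoot_mul_self, SignType.coe_mul]; ring
      · simp
    · intro t _ ht
      rw [hentry, if_neg (Ne.symm ht), zero_mul]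
    · simp
  have hmul : M.charpoly * M.charpoly = (-M).charpoly * M.charpoly := by rw [hneg]
  rw [hmul]
  refine Polynomial.funext fun x => ?_
  rw [eval_mul, Matrix.eval_charpoly, Matrix.eval_charpoly, ← Matrix.det_mul, eval_prod]
  have : (Matrix.scalar (Fin n) x - -M) * (Matrix.scalar (Fin n) x - M)
      = Matrix.diagonal fun u => x * x - P.pairRoot σ u * P.pairRoot σ u := by
    rw [sub_neg_eq_add, add_mul, mul_sub, mul_sub, hsq, Matrix.scalar_comm x
      (fun r => Commute.all x r) M]
    have h1 : Matrix.scalar (Fin n) x * Matrix.scalar (Fin n) x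
        = Matrix.diagonal fun _ => x * x := by
      rw [← map_mul]; rfl
    rw [h1, ← Matrix.diagonal_sub]
    abel
  rw [this, Matrix.det_diagonal]
  refine Finset.prod_congr rfl fun u _ => ?_
  simp
  ring

include hσ hχ in
-- The factor 2 reflects the squared characteristic polynomial, in which every `u` contributes a
-- root and its negative.
lemma two_mul_countP_matchingWeight (p : ℂ → Prop) [DecidablePred p] :
    2 * (eigenvalues (P.weighted (matchingWeight σ))).countP p
      = (Finset.univ.filter fun u => p (P.pairRoot σ u)).card
        + (Finset.univ.filter fun u => p (-P.pairRoot σ u)).card := by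
  have h := congrArg roots (P.charpoly_matchingWeight_mul_self hσ hχ)
  have hne : ((P.weighted (matchingWeight σ)).map (algebraMap ℝ ℂ)).charpoly ≠ 0 :=
    (Matrix.charpoly_monic _).ne_zero
  have h1 : ∏ u, ((X - C (P.pairRoot σ u)) * (X - C (-P.pairRoot σ u)))
      = ((Finset.univ.val.map (P.pairRoot σ) + Finset.univ.val.map fun u => -P.pairRoot σ u).map
        fun x => X - C x).prod := by
    rw [Finset.prod_mul_distrib, Multiset.map_add, Multiset.prod_add, Multiset.map_map,
      Multiset.map_map]
    rfl
  rw [roots_mul (mul_ne_zero hne hne), h1, roots_multiset_prod_X_sub_C] at h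
  have h2 := congrArg (Multiset.countP p) h
  rw [Multiset.countP_add, Multiset.countP_add, Multiset.countP_map_univ,
    Multiset.countP_map_univ] at h2
  rw [← h2, two_mul]
  rfl

lemma pairRoot_re_pos_iff (u : Fin n) :
    0 < (P.pairRoot σ u).re ↔ P u (σ u) * P (σ u) u = 1 := by
  have hw : (0 : ℝ) < pairWeight σ u := by exact_mod_cast pairWeight_pos σ u
  unfold pairRoot
  split_ifs with h1 h2
  · simpa [h1] using hw
  · simp [h2]
  · simp [h1]

include hσ hχ in
-- Each positive pair, counted here by its two vertices, gives one positive and one negative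
-- eigenvalue of the matching matrix, and an open half-plane keeps its eigenvalues under
-- perturbation.
theorem exists_card_pos_le_two_mul_pos :
    ∃ A ∈ P.qualitativeClass,
      (Finset.univ.filter fun u => P u (σ u) * P (σ u) u = 1).card ≤ 2 * (inertia A).1 := by
  obtain ⟨A, hA, h⟩ := P.exists_countP_le (matchingWeight_nonneg σ) (fun z => 0 < z.re)
    (isOpen_lt continuous_const Complex.continuous_re)
  refine ⟨A, hA, ?_⟩
  have h2 := P.two_mul_countP_matchingWeight hσ hχ (fun z => 0 < z.re)
  simp only [pairRoot_re_pos_iff] at h2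
  unfold inertia
  dsimp only
  omega

include hσ hχ in
theorem exists_card_pos_le_two_mul_neg :
    ∃ A ∈ P.qualitativeClass,
      (Finset.univ.filter fun u => P u (σ u) * P (σ u) u = 1).card ≤ 2 * (inertia A).2.1 := by
  obtain ⟨A, hA, h⟩ := P.exists_countP_le (matchingWeight_nonneg σ) (fun z => z.re < 0)
    (isOpen_lt Complex.continuous_re continuous_const)
  refine ⟨A, hA, ?_⟩
  have h2 := P.two_mul_countP_matchingWeight hσ hχ (fun z => z.re < 0)
  simp only [Complex.neg_re, neg_lt_zero, pairRoot_re_pos_iff] at h2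
  unfold inertia
  dsimp only
  omega

lemma Int.eq_of_abs_sub_le_quarter {a b : ℤ} (h : |(a : ℝ) - b| ≤ 1 / 4) : a = b := by
  have h1 : |((a - b : ℤ) : ℝ)| < 1 := by push_cast; linarith
  have h2 : |a - b| < 1 := by exact_mod_cast h1
  have := Int.abs_lt_one_iff.1 h2
  omega

/-- The imaginary part of `pairRoot`. -/
lemma pairRoot_im (u : Fin n) : (P.pairRoot σ u).im
    = ((if P u (σ u) * P (σ u) u = -1 then pairWeight σ u else 0 : ℤ) : ℝ) := by
  unfold pairRoot
  by_cases h : P u (σ u) * P (σ u) u = -1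
  · rw [h]; simp
  · rw [if_neg h, if_neg h]; split_ifs <;> simp

/-- The magnitude of the pair of `u`, with a sign that distinguishes the two members. -/
def axisCoord (σ : Fin n → Fin n) (χ : Fin n → Bool) (u : Fin n) : ℤ :=
  if χ u then pairWeight σ u else -pairWeight σ u

/-- The eigenvalues on the imaginary axis belonging to the vertices in negative pairs. -/
noncomputable def axisRoot (σ : Fin n → Fin n) (χ : Fin n → Bool) (u : Fin n) : ℂ :=
  (axisCoord σ χ u : ℂ) * Complex.I

lemma axisRoot_re (u : Fin n) : (axisRoot σ χ u).re = 0 := by simp [axisRoot]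

lemma axisRoot_im (u : Fin n) : (axisRoot σ χ u).im = axisCoord σ χ u := by simp [axisRoot]

include hσ hχ in
-- Different pairs have different integer magnitudes and positive pairs have real roots, so a
-- comparison of imaginary parts isolates the eigenvalue. The radius 1/4 makes the integers that
-- occur equal.
lemma countP_axisRoot {u : Fin n} (hu : P u (σ u) * P (σ u) u = -1) :
    1 ≤ (eigenvalues (P.weighted (matchingWeight σ))).countP
        (fun z => ‖z - axisRoot σ χ u‖ < 1 / 4) ∧
      (eigenvalues (P.weighted (matchingWeight σ))).countP
        (fun z => ‖z - axisRoot σ χ u‖ ≤ 1 / 4) ≤ 1 := by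
  have hroot : P.pairRoot σ u = pairWeight σ u * Complex.I := by
    unfold pairRoot; rw [hu]; simp
  constructor
  · have h := P.two_mul_countP_matchingWeight hσ hχ (fun z => ‖z - axisRoot σ χ u‖ < 1 / 4)
    have : 0 < (Finset.univ.filter fun v => ‖P.pairRoot σ v - axisRoot σ χ u‖ < 1 / 4).card
        + (Finset.univ.filter fun v => ‖-P.pairRoot σ v - axisRoot σ χ u‖ < 1 / 4).card := by
      rcases hc : χ u with _ | _
      · refine Nat.add_pos_right _
          (Finset.card_pos.2 ⟨u, Finset.mem_filter.2 ⟨Finset.mem_univ _, ?_⟩⟩)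
        rw [hroot, axisRoot, axisCoord, hc]
        simp
      · refine Nat.add_pos_left
          (Finset.card_pos.2 ⟨u, Finset.mem_filter.2 ⟨Finset.mem_univ _, ?_⟩⟩) _
        rw [hroot, axisRoot, axisCoord, hc]
        simp
    omega
  · have h := P.two_mul_countP_matchingWeight hσ hχ (fun z => ‖z - axisRoot σ χ u‖ ≤ 1 / 4)
    set J₁ := Finset.univ.filter fun v => ‖P.pairRoot σ v - axisRoot σ χ u‖ ≤ 1 / 4
    set J₂ := Finset.univ.filter fun v => ‖-P.pairRoot σ v - axisRoot σ χ u‖ ≤ 1 / 4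
    set a : ℤ := axisCoord σ χ u with ha
    have hpos := pairWeight_pos σ u
    have ha' : a = pairWeight σ u ∨ a = -pairWeight σ u := by
      rw [ha, axisCoord]; split_ifs <;> simp
    have him : (axisRoot σ χ u).im = (a : ℝ) := axisRoot_im u
    have h₁ : ∀ v ∈ J₁, (if P v (σ v) * P (σ v) v = -1 then pairWeight σ v else 0 : ℤ) = a := by
      intro v hv
      have := (Complex.abs_im_le_norm _).trans (Finset.mem_filter.1 hv).2
      rw [Complex.sub_im, pairRoot_im, him] at this
      exact Int.eq_of_abs_sub_le_quarter this
    have h₂ : ∀ v ∈ J₂, (if P v (σ v) * P (σ v) v = -1 then pairWeight σ v else 0 : ℤ) = -a := by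
      intro v hv
      have := (Complex.abs_im_le_norm _).trans (Finset.mem_filter.1 hv).2
      rw [Complex.sub_im, Complex.neg_im, pairRoot_im, him] at this
      have := Int.eq_of_abs_sub_le_quarter (b := a)
        (a := -(if P v (σ v) * P (σ v) v = -1 then pairWeight σ v else 0)) (by
          rw [Int.cast_neg]; exact this)
      omega
    have hdisj : Disjoint J₁ J₂ := Finset.disjoint_left.2 fun v hv₁ hv₂ => by
      have := h₁ v hv₁
      have := h₂ v hv₂
      omega
    -- The disjoint sets `J₁` and `J₂` count twice the eigenvalues in the disc, so containment in a
    -- set of two vertices leaves one eigenvalue.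
    have hsub : J₁ ∪ J₂ ⊆ {u, σ u} := by
      intro v hv
      have : (if P v (σ v) * P (σ v) v = -1 then pairWeight σ v else 0 : ℤ) = a ∨
          (if P v (σ v) * P (σ v) v = -1 then pairWeight σ v else 0 : ℤ) = -a := by
        rcases Finset.mem_union.1 hv with hv | hv
        exacts [Or.inl (h₁ v hv), Or.inr (h₂ v hv)]
      have hv := pairWeight_pos σ v
      have hw : pairWeight σ v = pairWeight σ u := by
        split_ifs at this <;> omega
      simpa using eq_or_eq_of_pairWeight_eq hσ hw
    have hcard := (Finset.card_le_card hsub).trans Finset.card_le_two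
    rw [Finset.card_union_of_disjoint hdisj] at hcard
    omega

include hχ in
-- The spectrum is invariant under negation, by bipartiteness, and under conjugation, because the
-- matrix is real.
lemma map_eigenvalues_reflection {A : Matrix (Fin n) (Fin n) ℝ}
    (hA : ∀ u v, P u v = 0 → A u v = 0) :
    (eigenvalues A).map (fun z => -starRingEnd ℂ z) = eigenvalues A := by
  have h1 : (eigenvalues A).map (fun z => -z) = eigenvalues A := by
    rw [eigenvalues, ← Matrix.roots_charpoly_neg, Matrix.charpoly_neg_of_bipartite χ]
    intro u v huv
    rw [Matrix.map_apply, hA u v (hχ u v huv), map_zero]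
  have h2 : (eigenvalues A).map (starRingEnd ℂ) = eigenvalues A := by
    rw [eigenvalues, charpoly_map_eq, Polynomial.map_conj_roots]
  conv_rhs => rw [← h1]
  conv_rhs => rw [← h2]
  rw [Multiset.map_map]
  rfl

include hσ hχ in
-- Every vertex of a negative pair has its own disc around an imaginary eigenvalue of the matching
-- matrix. A small perturbation keeps exactly one eigenvalue in the disc, and the reflection
-- symmetry holds it on the axis. These eigenvalues are nonzero, so the `m` zeros forced by `hX` are
-- additional.
theorem exists_card_neg_add_le_zero {m : ℕ}
    (hX : ∀ A ∈ P.qualitativeClass, (X : ℝ[X]) ^ m ∣ A.charpoly) :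
    ∃ A ∈ P.qualitativeClass,
      (Finset.univ.filter fun u => P u (σ u) * P (σ u) u = -1).card + m ≤ (inertia A).2.2 := by
  set S := Finset.univ.filter fun u => P u (σ u) * P (σ u) u = -1 with hS
  have hSσ : ∀ u ∈ S, χ (σ u) ≠ χ u := by
    intro u hu h
    have := (Finset.mem_filter.1 hu).2
    rw [hχ _ _ h] at this
    simp at this
  have hlim := P.tendsto_weighted_map (matchingWeight σ)
  have hev : ∀ᶠ ε in 𝓝[>] (0 : ℝ), ∀ u ∈ S,
      1 ≤ (eigenvalues (P.weighted fun i j => matchingWeight σ i j + ε)).countP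
          (fun z => ‖z - axisRoot σ χ u‖ < 1 / 4) ∧
        (eigenvalues (P.weighted fun i j => matchingWeight σ i j + ε)).countP
          (fun z => ‖z - axisRoot σ χ u‖ ≤ 1 / 4) ≤ 1 := by
    rw [Finset.eventually_all]
    intro u hu
    obtain ⟨h1, h2⟩ := P.countP_axisRoot hσ hχ (Finset.mem_filter.1 hu).2
    filter_upwards [Matrix.eventually_countP_roots_le hlim
        (fun z => ‖z - axisRoot σ χ u‖ < 1 / 4) (isOpen_lt (by fun_prop) continuous_const),
      Matrix.eventually_countP_roots_ge hlim
        (fun z => ‖z - axisRoot σ χ u‖ ≤ 1 / 4) (isClosed_le (by fun_prop) continuous_const)]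
      with ε h3 h4
    exact ⟨h1.trans h3, h4.trans h2⟩
  obtain ⟨ε, hε, hpos⟩ := (hev.and self_mem_nhdsWithin).exists
  set A := P.weighted fun i j => matchingWeight σ i j + ε with hAdef
  have hA : A ∈ P.qualitativeClass :=
    P.weighted_mem fun i j => add_pos_of_nonneg_of_pos (matchingWeight_nonneg σ i j) hpos
  refine ⟨A, hA, ?_⟩
  have hrefl := P.map_eigenvalues_reflection hχ (A := A) fun u v => P.apply_eq_zero_of_mem hA
  have hex : ∀ u, ∃ z : ℂ, u ∈ S →
      z ∈ eigenvalues A ∧ z.re = 0 ∧ ‖z - axisRoot σ χ u‖ < 1 / 4 := by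
    intro u
    by_cases hu : u ∈ S
    · obtain ⟨z, hz⟩ := Multiset.exists_mem_imaginary (eigenvalues A) hrefl
        (c := axisRoot σ χ u) (axisRoot_re u) (hε u hu).1 (hε u hu).2
      exact ⟨z, fun _ => hz⟩
    · exact ⟨0, fun h => absurd h hu⟩
  choose ζ hζ using hex
  have him : ∀ u ∈ S, |(ζ u).im - axisCoord σ χ u| < 1 / 4 := by
    intro u hu
    have := (Complex.abs_im_le_norm _).trans_lt (hζ u hu).2.2
    rwa [Complex.sub_im, axisRoot_im] at this
  refine Multiset.card_add_le_countP_imaginary (eigenvalues A) ?_ S ζ ?_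
    (fun u hu => (hζ u hu).1) (fun u hu => (hζ u hu).2.1) ?_
  · rw [eigenvalues, charpoly_map_eq, count_roots,
      le_rootMultiplicity_iff (A.charpoly_monic.map _).ne_zero, C_0, sub_zero]
    have := Polynomial.map_dvd (algebraMap ℝ ℂ) (hX A hA)
    rwa [Polynomial.map_pow, map_X] at this
  -- A common eigenvalue forces equal coordinates, hence the same pair and the same colour. The two
  -- members of a negative pair have different colours, so the vertices coincide.
  · intro u hu v hv huv
    have h1 := him u hu
    have h2 := him v hv
    rw [← huv] at h2
    rw [abs_lt] at h1 h2
    have huv' : axisCoord σ χ v = axisCoord σ χ u := by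
      have h3 : |((axisCoord σ χ v - axisCoord σ χ u : ℤ) : ℝ)| < 1 := by
        push_cast
        rw [abs_lt]
        constructor <;> linarith [h1.1, h2.2, h1.2, h2.1]
      have h4 : |axisCoord σ χ v - axisCoord σ χ u| < 1 := by exact_mod_cast h3
      have := Int.abs_lt_one_iff.1 h4
      omega
    unfold axisCoord at huv'
    have hu0 := pairWeight_pos σ u
    have hv0 := pairWeight_pos σ v
    have hχuv : χ v = χ u ∧ pairWeight σ v = pairWeight σ u := by
      cases hcu : χ u <;> cases hcv : χ v <;> simp only [hcu, hcv, if_true, if_false,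
        Bool.false_eq_true] at huv' <;> first | omega | exact ⟨rfl, by omega⟩
    rcases eq_or_eq_of_pairWeight_eq hσ hχuv.2 with h | h
    · exact h.symm
    · exact absurd (h ▸ hχuv.1) (hSσ u hu)
  · intro u hu h0
    have h1 := him u hu
    rw [h0, Complex.zero_im] at h1
    have hu0 := pairWeight_pos σ u
    have := Int.eq_of_abs_sub_le_quarter (a := 0) (b := axisCoord σ χ u) (by
      rw [Int.cast_zero]; exact h1.le)
    unfold axisCoord at this
    split_ifs at this <;> omega

include hσ hχ in
/-- A bound for the positive pairs of one matching and the negative pairs of another one. -/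
theorem card_pos_add_card_neg_le (hP : P.RequiresUniqueInertia) {τ : Fin n → Fin n}
    (hτ : Function.Involutive τ) {m : ℕ}
    (hX : ∀ A ∈ P.qualitativeClass, (X : ℝ[X]) ^ m ∣ A.charpoly) :
    (Finset.univ.filter fun u => P u (σ u) * P (σ u) u = 1).card
      + (Finset.univ.filter fun u => P u (τ u) * P (τ u) u = -1).card + m ≤ n := by
  obtain ⟨A, hA, h1⟩ := P.exists_card_pos_le_two_mul_pos hσ hχ
  obtain ⟨B, hB, h2⟩ := P.exists_card_pos_le_two_mul_neg hσ hχ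
  obtain ⟨D, hD, h3⟩ := P.exists_card_neg_add_le_zero hτ hχ hX
  rw [hP B hB A hA] at h2
  rw [hP D hD A hA] at h3
  have := inertia_sum A
  omega

end Matching

end SignPattern

/-! ### Multiplicity of zero from the support of columns. -/

lemma Matrix.X_pow_dvd_charpoly_of_support {n : ℕ} {A : Matrix (Fin n) (Fin n) ℝ}
    {E O : Finset (Fin n)} (hA : ∀ v ∈ E, ∀ u ∉ O, A u v = 0) {m : ℕ} (hm : m + O.card ≤ E.card) :
    (X : ℝ[X]) ^ m ∣ A.charpoly := by
  let L : (E → ℝ) →ₗ[ℝ] (O → ℝ) := Matrix.toLin' (A.submatrix Subtype.val Subtype.val)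
  let J : (E → ℝ) →ₗ[ℝ] (Fin n → ℝ) := Function.ExtendByZero.linearMap ℝ Subtype.val
  have hJ : Function.Injective J := by
    intro x y hxy
    ext i
    have h1 := congrFun hxy i.val
    simpa [J, Function.ExtendByZero.linearMap_apply] using h1
  have hJE : ∀ x : E → ℝ, ∀ i : E, J x i.val = x i := fun x i => by
    simp [J, Function.ExtendByZero.linearMap_apply]
  have hJ0 : ∀ x : E → ℝ, ∀ v ∉ E, J x v = 0 := fun x v hv => by
    simp only [J, Function.ExtendByZero.linearMap_apply]
    rw [Function.extend_apply' _ _ _ (by rintro ⟨i, rfl⟩; exact hv i.2)]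
    rfl
  -- The columns in `E` are supported on the rows in `O`. Hence the kernel of the block `L`, of
  -- dimension at least `E.card - O.card`, extends by zero into the kernel of `A`. Geometric
  -- multiplicity is at most algebraic multiplicity.
  have hker : L.ker.map J ≤ Module.End.eigenspace (Matrix.toLin' A) 0 := by
    rintro _ ⟨x, hx, rfl⟩
    rw [Module.End.mem_eigenspace_iff, zero_smul, Matrix.toLin'_apply]
    ext u
    rw [Matrix.mulVec, dotProduct, Pi.zero_apply]
    by_cases hu : u ∈ O
    · have h1 := congrFun (LinearMap.mem_ker.1 hx) ⟨u, hu⟩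
      simp only [L, Matrix.toLin'_apply, Matrix.mulVec, dotProduct, Matrix.submatrix_apply,
        Pi.zero_apply] at h1
      rw [← h1, ← Finset.sum_subset (Finset.subset_univ E)
        (fun v _ hv => by rw [hJ0 x v hv, mul_zero]), ← Finset.sum_coe_sort E]
      exact Finset.sum_congr rfl fun i _ => by rw [hJE]
    · refine Finset.sum_eq_zero fun v _ => ?_
      by_cases hv : v ∈ E
      · rw [hA v hv u hu, zero_mul]
      · rw [hJ0 x v hv, mul_zero]
  have h1 := Submodule.finrank_mono hker
  rw [(Submodule.equivMapOfInjective J hJ L.ker).finrank_eq.symm] at h1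
  have h2 := L.finrank_range_add_finrank_ker
  have h3 := L.range.finrank_le
  rw [Module.finrank_fintype_fun_eq_card, Fintype.card_coe] at h2 h3
  have h4 := LinearMap.finrank_eigenspace_le (Matrix.toLin' A) 0
  rw [Matrix.charpoly_toLin'] at h4
  have h5 := (le_rootMultiplicity_iff A.charpoly_monic.ne_zero (a := 0) (n := m)).1 (by omega)
  simpa using h5

namespace SignPattern

variable {n : ℕ} {P : SignPattern n}

/-! ### Distances to the cycle, the matching off the cycle, and bipartiteness. -/

section Graph

lemma graph_adj_iff (hsymm : P.IsCombinatoriallySymmetric) (hdiag : P.HasZeroDiagonal)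
    {u v : Fin n} : P.graph.Adj u v ↔ P u v ≠ 0 := by
  rw [graph, SimpleGraph.fromRel_adj]
  constructor
  · rintro ⟨-, h | h⟩
    exacts [h, (hsymm _ _).2 h]
  · intro h
    refine ⟨?_, Or.inl h⟩
    rintro rfl
    exact h (hdiag u)

lemma graph_connected (hirr : P.IsIrreducible) (hsymm : P.IsCombinatoriallySymmetric)
    (hdiag : P.HasZeroDiagonal) (u : Fin n) : P.graph.Connected := by
  have h : ∀ a b, P.graph.Reachable a b := by
    intro a
    by_contra! hcon
    obtain ⟨b, hb⟩ := hcon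
    obtain ⟨i, hi, j, hj, hij⟩ := hirr {v | P.graph.Reachable a v} ⟨a, .refl a⟩ (by
      intro h
      exact hb (h ▸ Set.mem_univ b : b ∈ {v | P.graph.Reachable a v}))
    exact hj (SimpleGraph.Reachable.trans hi ((graph_adj_iff hsymm hdiag).2 hij).reachable)
  exact { preconnected := h, nonempty := ⟨u⟩ }

variable {u : Fin n} {C : P.graph.Walk u u}

lemma exists_distToCycle_eq (C : P.graph.Walk u u) (v : Fin n) :
    ∃ w ∈ C.support, P.distToCycle C v = P.graph.dist v w :=
  Nat.sInf_mem (s := {d | ∃ w ∈ C.support, d = P.graph.dist v w}) ⟨_, u, C.start_mem_support, rfl⟩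

lemma distToCycle_le {w : Fin n} (hw : w ∈ C.support) (v : Fin n) :
    P.distToCycle C v ≤ P.graph.dist v w :=
  Nat.sInf_le ⟨w, hw, rfl⟩

variable (hconn : P.graph.Connected)
include hconn

lemma distToCycle_eq_zero_iff {v : Fin n} : P.distToCycle C v = 0 ↔ v ∈ C.support := by
  constructor
  · intro h
    obtain ⟨w, hw, hd⟩ := exists_distToCycle_eq C v
    rw [h] at hd
    rwa [hconn.dist_eq_zero_iff.1 hd.symm]
  · intro h
    have := distToCycle_le h v
    rw [SimpleGraph.dist_self] at this
    omega

lemma distToCycle_le_add_one {v w : Fin n} (h : P.graph.Adj v w) :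
    P.distToCycle C v ≤ P.distToCycle C w + 1 := by
  obtain ⟨x, hx, hd⟩ := exists_distToCycle_eq C w
  have h1 := distToCycle_le hx v
  have h2 := hconn.dist_triangle (u := v) (v := w) (w := x)
  rw [SimpleGraph.dist_eq_one_iff_adj.2 h] at h2
  omega

lemma exists_parent {v : Fin n} (hv : P.distToCycle C v ≠ 0) :
    ∃ w, P.graph.Adj v w ∧ P.distToCycle C w + 1 = P.distToCycle C v := by
  obtain ⟨x, hx, hd⟩ := exists_distToCycle_eq C v
  obtain ⟨p, hp⟩ := hconn.exists_walk_length_eq_dist v x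
  cases p with
  | nil => rw [SimpleGraph.dist_self] at hd; exact absurd hd hv
  | @cons _ w _ h p =>
    refine ⟨w, h, ?_⟩
    have h1 := (distToCycle_le hx w).trans (SimpleGraph.dist_le p)
    have h2 := distToCycle_le_add_one hconn (C := C) h
    rw [SimpleGraph.Walk.length_cons] at hp
    omega

/-- Each step towards the cycle lowers the distance below that of `v`, so the descent misses `v`; it
then follows the cycle, which does not contain `v`. -/
lemma exists_walk_to_cycle {v : Fin n} (hv : P.distToCycle C v ≠ 0) {w : Fin n} (hwv : w ≠ v)
    (hle : P.distToCycle C w ≤ P.distToCycle C v) :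
    ∃ p : P.graph.Walk w u, v ∉ p.support := by
  induction hd : P.distToCycle C w using Nat.strong_induction_on generalizing w with
  | _ d ih =>
  by_cases h0 : P.distToCycle C w = 0
  · have hw := (distToCycle_eq_zero_iff hconn).1 h0
    refine ⟨C.dropUntil w hw, fun h => hv ?_⟩
    exact (distToCycle_eq_zero_iff hconn).2 (C.support_dropUntil_subset_support hw h)
  · obtain ⟨x, hx, hxd⟩ := exists_parent hconn h0
    obtain ⟨p, hp⟩ := ih (P.distToCycle C x) (by omega) (w := x) (by rintro rfl; omega)
      (by omega) rfl
    refine ⟨.cons hx p, ?_⟩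
    rw [SimpleGraph.Walk.support_cons, List.mem_cons]
    rintro (h | h)
    exacts [hwv h.symm, hp h]

/-- Two such neighbours would be joined by a path avoiding `v`. Closing it through `v` gives a cycle
through a vertex off the only cycle. -/
lemma parent_unique (hC : P.IsUniqueCycle C) {v : Fin n} (hv : P.distToCycle C v ≠ 0)
    {w x : Fin n} (hw : P.graph.Adj v w) (hx : P.graph.Adj v x)
    (hwd : P.distToCycle C w ≤ P.distToCycle C v) (hxd : P.distToCycle C x ≤ P.distToCycle C v) :
    w = x := by
  by_contra hne
  obtain ⟨p, hp⟩ := exists_walk_to_cycle hconn hv hw.ne' hwd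
  obtain ⟨q, hq⟩ := exists_walk_to_cycle hconn hv hx.ne' hxd
  set r := (p.append q.reverse).bypass with hr
  have hrv : v ∉ r.support := fun h => by
    have := SimpleGraph.Walk.support_bypass_subset_support _ h
    rw [SimpleGraph.Walk.mem_support_append_iff, SimpleGraph.Walk.support_reverse,
      List.mem_reverse] at this
    exact this.elim hp hq
  have hcyc : (SimpleGraph.Walk.cons hw (r.concat hx.symm)).IsCycle := by
    rw [SimpleGraph.Walk.cons_isCycle_iff]
    refine ⟨((p.append q.reverse).bypass_isPath).concat hrv hx.symm, ?_⟩
    rw [SimpleGraph.Walk.edges_concat, List.concat_eq_append, List.mem_append]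
    rintro (h | h)
    · exact hrv (r.fst_mem_support_of_mem_edges h)
    · rw [List.mem_singleton, Sym2.eq_iff] at h
      rcases h with ⟨h, -⟩ | ⟨-, h⟩
      exacts [hx.ne h, hne h]
  have hmem := (hC.2 _ _ hcyc s(v, w)).1 (by simp)
  exact hv ((distToCycle_eq_zero_iff hconn).2 (C.fst_mem_support_of_mem_edges hmem))

/-- Without a neighbour further away, the parent would be the only neighbour, making `v` a leaf at
odd distance. -/
lemma exists_child (hC : P.IsUniqueCycle C)
    (hleaf : ∀ v, P.IsLeaf v → Even (P.distToCycle C v)) {v : Fin n}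
    (hv : Odd (P.distToCycle C v)) :
    ∃ w, P.graph.Adj v w ∧ P.distToCycle C w = P.distToCycle C v + 1 := by
  by_contra! hcon
  have hv0 : P.distToCycle C v ≠ 0 := by rintro h; simp [h] at hv
  obtain ⟨w, hw, hwd⟩ := exists_parent hconn hv0
  refine Nat.not_even_iff_odd.2 hv (hleaf v ⟨w, hw, fun x hx => ?_⟩)
  have h1 := distToCycle_le_add_one hconn (C := C) hx.symm
  have h2 := hcon x hx
  exact parent_unique hconn hC hv0 hx hw (by omega) (by omega)

/-- The vertices at odd distance from the cycle can be matched to vertices at even distance, off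
the cycle. The number of unmatched vertices off the cycle is a lower bound for the multiplicity of
the eigenvalue zero. -/
theorem exists_tree_matching (hsymm : P.IsCombinatoriallySymmetric) (hdiag : P.HasZeroDiagonal)
    (hC : P.IsUniqueCycle C) (hleaf : ∀ v, P.IsLeaf v → Even (P.distToCycle C v)) :
    ∃ ρ : Fin n → Fin n, Function.Involutive ρ ∧ (∀ v ∈ C.support, ρ v = v) ∧
      (∀ v, ρ v ≠ v → P v (ρ v) ≠ 0) ∧
      ∀ A ∈ P.qualitativeClass,
        (X : ℝ[X]) ^ (Finset.univ.filter fun v => v ∉ C.support ∧ ρ v = v).card ∣ A.charpoly := by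
  set D := P.distToCycle C with hD
  have hpar : ∀ v, ∃ w, D v ≠ 0 → P.graph.Adj v w ∧ D w + 1 = D v := fun v => by
    by_cases h : D v = 0
    · exact ⟨v, fun h' => absurd h h'⟩
    · exact (exists_parent hconn h).imp fun w hw _ => hw
  have hch : ∀ v, ∃ w, Odd (D v) → P.graph.Adj v w ∧ D w = D v + 1 := fun v => by
    by_cases h : Odd (D v)
    · exact (exists_child hconn hC hleaf h).imp fun w hw _ => hw
    · exact ⟨v, fun h' => absurd h' h⟩
  choose par hpar using hpar
  choose ch hch using hch
  have hparch : ∀ v, Odd (D v) → par (ch v) = v := by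
    intro v hv
    obtain ⟨h1, h2⟩ := hch v hv
    have h0 : D (ch v) ≠ 0 := by omega
    obtain ⟨h3, h4⟩ := hpar (ch v) h0
    exact parent_unique hconn hC h0 h3 h1.symm (show D _ ≤ D _ by omega)
      (show D _ ≤ D _ by omega)
  -- A vertex at odd distance goes to its chosen child. A vertex at even distance goes to its parent
  -- only if it is the child chosen there; otherwise it is fixed.
  let ρ : Fin n → Fin n := fun v =>
    if Odd (D v) then ch v else if D v ≠ 0 ∧ ch (par v) = v then par v else v
  have hρodd : ∀ v, Odd (D v) → ρ v = ch v := fun v hv => if_pos hv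
  have hρpar : ∀ v, ¬ Odd (D v) → D v ≠ 0 → ch (par v) = v → ρ v = par v := fun v h1 h2 h3 => by
    simp only [ρ]; rw [if_neg h1, if_pos ⟨h2, h3⟩]
  have hρfix : ∀ v, ¬ Odd (D v) → ¬ (D v ≠ 0 ∧ ch (par v) = v) → ρ v = v := fun v h1 h2 => by
    simp only [ρ]; rw [if_neg h1, if_neg h2]
  have hinv : Function.Involutive ρ := by
    intro v
    by_cases h1 : Odd (D v)
    · have h2 := (hch v h1).2
      rw [hρodd v h1, hρpar (ch v) (by rw [h2]; simpa [Nat.even_add_one] using h1) (by omega)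
        (by rw [hparch v h1]), hparch v h1]
    · by_cases h2 : D v ≠ 0 ∧ ch (par v) = v
      · have h3 := (hpar v h2.1).2
        have h4 : Odd (D (par v)) := by
          rw [← h3, Nat.odd_add_one, not_not] at h1; exact h1
        rw [hρpar v h1 h2.1 h2.2, hρodd _ h4, h2.2]
      · rw [hρfix v h1 h2, hρfix v h1 h2]
  have hadj : ∀ v, ρ v ≠ v → P.graph.Adj v (ρ v) := by
    intro v hv
    by_cases h1 : Odd (D v)
    · rw [hρodd v h1]; exact (hch v h1).1
    · by_cases h2 : D v ≠ 0 ∧ ch (par v) = v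
      · rw [hρpar v h1 h2.1 h2.2]; exact (hpar v h2.1).1
      · exact absurd (hρfix v h1 h2) hv
  refine ⟨ρ, hinv, ?_, fun v hv => (graph_adj_iff hsymm hdiag).1 (hadj v hv), ?_⟩
  · intro v hv
    have h0 : D v = 0 := (distToCycle_eq_zero_iff hconn).2 hv
    exact hρfix v (by simp [h0]) (by simp [h0])
  · intro A hA
    -- All neighbours of a vertex at positive even distance are at odd distance, so the columns in
    -- `E` have their support in `O`. As `ρ` injects `O` into the matched part of `E`, the unmatched
    -- vertices number at most `E.card - O.card`.
    refine Matrix.X_pow_dvd_charpoly_of_support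
      (E := Finset.univ.filter fun v => D v ≠ 0 ∧ ¬ Odd (D v))
      (O := Finset.univ.filter fun v => Odd (D v)) ?_ ?_
    · intro v hv w hw
      rw [Finset.mem_filter] at hv hw
      refine P.apply_eq_zero_of_mem hA ?_
      by_contra hwv
      have hvw : P.graph.Adj v w := ((graph_adj_iff hsymm hdiag).2 hwv).symm
      have h1 : D v ≤ D w + 1 := distToCycle_le_add_one hconn hvw
      have h2 : D w ≤ D v + 1 := distToCycle_le_add_one hconn hvw.symm
      obtain ⟨h3, h4⟩ := hpar v hv.2.1
      have h5 : ¬ Odd (D w) := fun h => hw ⟨Finset.mem_univ _, h⟩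
      have h6 := hv.2.2
      rw [Nat.not_odd_iff_even] at h5 h6
      obtain ⟨a, ha⟩ := h5
      obtain ⟨b, hb⟩ := h6
      have h7 : w = par v :=
        parent_unique hconn hC hv.2.1 hvw h3 (show D w ≤ D v by omega) (show D _ ≤ D v by omega)
      rw [← h7] at h4
      omega
    · have hmaps : (Finset.univ.filter fun v => Odd (D v)).card
          ≤ (Finset.univ.filter fun v => (D v ≠ 0 ∧ ¬ Odd (D v)) ∧ ρ v ≠ v).card := by
        refine Finset.card_le_card_of_injOn ρ ?_ (hinv.injective.injOn)
        intro v hv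
        have hv : Odd (D v) := (Finset.mem_filter.1 hv).2
        have h2 := (hch v hv).2
        simp only [Finset.coe_filter, Finset.mem_univ, true_and, Set.mem_ofPred_eq]
        rw [hinv v, hρodd v hv]
        refine ⟨⟨by omega, by rw [h2]; simpa [Nat.even_add_one] using hv⟩, fun h => ?_⟩
        rw [← h] at h2
        omega
      have hfix : (Finset.univ.filter fun v => v ∉ C.support ∧ ρ v = v)
          = Finset.univ.filter fun v => (D v ≠ 0 ∧ ¬ Odd (D v)) ∧ ¬ ρ v ≠ v := by
        refine Finset.filter_congr fun v _ => ?_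
        rw [← distToCycle_eq_zero_iff hconn, not_not]
        constructor
        · rintro ⟨h1, h2⟩
          refine ⟨⟨h1, fun h3 => ?_⟩, h2⟩
          have h4 := (hch v h3).2
          rw [← hρodd v h3, h2] at h4
          omega
        · rintro ⟨⟨h1, -⟩, h2⟩
          exact ⟨h1, h2⟩
      rw [hfix]
      have h8 := Finset.card_filter_add_card_filter_not
        (s := Finset.univ.filter fun v => D v ≠ 0 ∧ ¬ Odd (D v)) (fun v => ρ v ≠ v)
      rw [Finset.filter_filter, Finset.filter_filter] at h8
      omega

omit hconn

/-- A graph whose only cycle is even is bipartite. -/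
theorem exists_bipartition (hsymm : P.IsCombinatoriallySymmetric) (hdiag : P.HasZeroDiagonal)
    (hC : P.IsUniqueCycle C) (heven : Even C.length) :
    ∃ χ : Fin n → Bool, ∀ u v, χ u = χ v → P u v = 0 := by
  obtain ⟨hcyc, huniq⟩ := hC
  cases C with
  | nil => exact absurd rfl hcyc.ne_nil
  | @cons _ w _ h p =>
    set G' := P.graph.deleteEdges {s(u, w)} with hG'
    -- Deleting one edge of the cycle leaves a forest, which is two-colourable. The rest of the
    -- cycle is a walk of odd length between the ends of the deleted edge, so these also get
    -- different colours.
    have hacyc : G'.IsAcyclic := by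
      intro v D hD
      have hle : G' ≤ P.graph := SimpleGraph.deleteEdges_le _
      have h1 := (huniq v (D.mapLe hle) (hD.mapLe hle) s(u, w)).2 (by simp)
      rw [SimpleGraph.Walk.edges_mapLe_eq_edges] at h1
      have := D.edges_subset_edgeSet h1
      simp [hG'] at this
    have hp := (SimpleGraph.Walk.cons_isCycle_iff p h).1 hcyc
    let p' : G'.Walk w u := p.transfer G' fun e he => by
      rw [hG', SimpleGraph.edgeSet_deleteEdges]
      refine ⟨p.edges_subset_edgeSet he, fun h => ?_⟩
      rw [Set.mem_singleton_iff] at h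
      exact hp.2 (h ▸ he)
    obtain ⟨col⟩ := hacyc.colorable_two
    let colB : G'.Coloring Bool := SimpleGraph.Coloring.mk (fun v => decide (col v = 0)) (by
      intro a b hab
      have := col.valid hab
      generalize col a = x at *
      generalize col b = y at *
      revert x y
      decide)
    refine ⟨colB, fun a b hab => ?_⟩
    by_contra hne
    have hadj := (graph_adj_iff hsymm hdiag).2 hne
    by_cases he : s(a, b) = s(u, w)
    · have hlen : ¬ Even p'.length := by
        rw [SimpleGraph.Walk.length_transfer]
        rw [SimpleGraph.Walk.length_cons, Nat.even_add_one] at heven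
        exact heven
      rw [colB.even_length_iff_congr p'] at hlen
      have hwu : colB w = colB u := by
        rw [Sym2.eq_iff] at he
        rcases he with ⟨rfl, rfl⟩ | ⟨rfl, rfl⟩
        exacts [hab.symm, hab]
      exact hlen (by rw [hwu])
    · refine colB.valid (v := a) (w := b) ?_ hab
      rw [hG', SimpleGraph.deleteEdges_adj]
      exact ⟨hadj, he⟩

end Graph

end SignPattern

/-! ### Positions on a cycle. -/

section SimpleGraphCycle

variable {V : Type*} {G : SimpleGraph V} {u : V} {C : G.Walk u u}

lemma SimpleGraph.Walk.edges_eq_map_range {v : V} (p : G.Walk u v) :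
    p.edges = (List.range p.length).map fun i => s(p.getVert i, p.getVert (i + 1)) := by
  refine List.ext_getElem (by simp) fun i h1 h2 => ?_
  simp [SimpleGraph.Walk.getElem_edges]

lemma SimpleGraph.Walk.IsCycle.getVert_inj (hC : C.IsCycle) {i j : ℕ} (hi : i < C.length)
    (hj : j < C.length) (h : C.getVert i = C.getVert j) : i = j :=
  hC.getVert_injOn' (show i ≤ C.length - 1 by omega) (show j ≤ C.length - 1 by omega) h

lemma SimpleGraph.Walk.exists_lt_getVert_eq_of_mem (hC : C.IsCycle) {v : V}
    (hv : v ∈ C.support) : ∃ i < C.length, C.getVert i = v := by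
  obtain ⟨i, hi, hle⟩ := SimpleGraph.Walk.mem_support_iff_exists_getVert.1 hv
  have := hC.three_le_length
  rcases hle.lt_or_eq with h | h
  · exact ⟨i, h, hi⟩
  · refine ⟨0, by omega, ?_⟩
    rw [← hi, h, C.getVert_length, C.getVert_zero]

/-- The successor modulo the length of a cycle. -/
def cyclicSucc (k i : ℕ) : ℕ := if i + 1 = k then 0 else i + 1

lemma SimpleGraph.Walk.getVert_cyclicSucc (i : ℕ) :
    C.getVert (cyclicSucc C.length i) = C.getVert (i + 1) := by
  unfold cyclicSucc
  split_ifs with h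
  · rw [h, C.getVert_length, C.getVert_zero]
  · rfl

open Classical in
/-- The position of a vertex on a cycle. -/
noncomputable def SimpleGraph.Walk.cycleIndex (C : G.Walk u u) (v : V) : ℕ :=
  if h : ∃ i < C.length, C.getVert i = v then h.choose else 0

lemma SimpleGraph.Walk.IsCycle.cycleIndex_spec (hC : C.IsCycle) {v : V} (hv : v ∈ C.support) :
    C.cycleIndex v < C.length ∧ C.getVert (C.cycleIndex v) = v := by
  have h := SimpleGraph.Walk.exists_lt_getVert_eq_of_mem hC hv
  rw [SimpleGraph.Walk.cycleIndex, dif_pos h]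
  exact h.choose_spec

lemma SimpleGraph.Walk.IsCycle.cycleIndex_getVert (hC : C.IsCycle) {i : ℕ} (hi : i < C.length) :
    C.cycleIndex (C.getVert i) = i := by
  obtain ⟨h1, h2⟩ := hC.cycleIndex_spec (C.getVert_mem_support i)
  exact hC.getVert_inj h1 hi h2

end SimpleGraphCycle

/-! ### Maps given on the cycle and off it. -/

section Glue

variable {n : ℕ} {G : SimpleGraph (Fin n)} {u : Fin n} {C : G.Walk u u}

open SimpleGraph.Walk

/-- The map that acts as `t` on the positions of a cycle and as `ρ` off the cycle. -/
noncomputable def SimpleGraph.Walk.glue (C : G.Walk u u) (t : ℕ → ℕ) (ρ : Fin n → Fin n)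
    (v : Fin n) : Fin n :=
  if v ∈ C.support then C.getVert (t (C.cycleIndex v)) else ρ v

lemma SimpleGraph.Walk.glue_of_notMem {t : ℕ → ℕ} {ρ : Fin n → Fin n} {v : Fin n}
    (hv : v ∉ C.support) : C.glue t ρ v = ρ v := if_neg hv

lemma SimpleGraph.Walk.IsCycle.glue_getVert (hC : C.IsCycle) {t : ℕ → ℕ} {ρ : Fin n → Fin n}
    {i : ℕ} (hi : i < C.length) : C.glue t ρ (C.getVert i) = C.getVert (t i) := by
  rw [glue, if_pos (C.getVert_mem_support i), hC.cycleIndex_getVert hi]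

lemma SimpleGraph.Walk.notMem_support_of_involutive {ρ : Fin n → Fin n}
    (hρ : Function.Involutive ρ) (hρC : ∀ v ∈ C.support, ρ v = v) {v : Fin n}
    (hv : v ∉ C.support) : ρ v ∉ C.support := fun h => by
  have := hρC _ h
  rw [hρ v] at this
  exact hv (this ▸ h)

lemma SimpleGraph.Walk.IsCycle.glue_injective (hC : C.IsCycle) {t : ℕ → ℕ} {ρ : Fin n → Fin n}
    (ht : ∀ i < C.length, t i < C.length)
    (htinj : ∀ i < C.length, ∀ j < C.length, t i = t j → i = j)
    (hρ : Function.Involutive ρ) (hρC : ∀ v ∈ C.support, ρ v = v) :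
    Function.Injective (C.glue t ρ) := by
  intro v w hvw
  by_cases hv : v ∈ C.support <;> by_cases hw : w ∈ C.support
  · obtain ⟨i, hi, rfl⟩ := exists_lt_getVert_eq_of_mem hC hv
    obtain ⟨j, hj, rfl⟩ := exists_lt_getVert_eq_of_mem hC hw
    rw [hC.glue_getVert hi, hC.glue_getVert hj] at hvw
    rw [htinj i hi j hj (hC.getVert_inj (ht i hi) (ht j hj) hvw)]
  · obtain ⟨i, hi, rfl⟩ := exists_lt_getVert_eq_of_mem hC hv
    rw [hC.glue_getVert hi, glue_of_notMem hw] at hvw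
    exact absurd (hvw ▸ C.getVert_mem_support _) (notMem_support_of_involutive hρ hρC hw)
  · obtain ⟨j, hj, rfl⟩ := exists_lt_getVert_eq_of_mem hC hw
    rw [hC.glue_getVert hj, glue_of_notMem hv] at hvw
    exact absurd (hvw ▸ C.getVert_mem_support _) (notMem_support_of_involutive hρ hρC hv)
  · rw [glue_of_notMem hv, glue_of_notMem hw] at hvw
    exact hρ.injective hvw

lemma SimpleGraph.Walk.IsCycle.glue_involutive (hC : C.IsCycle) {t : ℕ → ℕ} {ρ : Fin n → Fin n}
    (ht : ∀ i < C.length, t i < C.length ∧ t (t i) = i)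
    (hρ : Function.Involutive ρ) (hρC : ∀ v ∈ C.support, ρ v = v) :
    Function.Involutive (C.glue t ρ) := by
  intro v
  by_cases hv : v ∈ C.support
  · obtain ⟨i, hi, rfl⟩ := exists_lt_getVert_eq_of_mem hC hv
    rw [hC.glue_getVert hi, hC.glue_getVert (ht i hi).1, (ht i hi).2]
  · rw [glue_of_notMem hv, glue_of_notMem (notMem_support_of_involutive hρ hρC hv), hρ v]

lemma SimpleGraph.Walk.IsCycle.filter_mem_support (hC : C.IsCycle) :
    (Finset.univ.filter fun v => v ∈ C.support) = (Finset.range C.length).image C.getVert := by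
  ext v
  simp only [Finset.mem_filter, Finset.mem_univ, true_and, Finset.mem_image, Finset.mem_range]
  constructor
  · exact exists_lt_getVert_eq_of_mem hC
  · rintro ⟨i, -, rfl⟩
    exact C.getVert_mem_support i

lemma SimpleGraph.Walk.IsCycle.prod_eq {M : Type*} [CommMonoid M] (hC : C.IsCycle)
    (f : Fin n → M) : ∏ v, f v = (∏ i ∈ Finset.range C.length, f (C.getVert i))
      * ∏ v ∈ Finset.univ.filter (fun v => v ∉ C.support), f v := by
  rw [← Finset.prod_filter_mul_prod_filter_not Finset.univ (fun v => v ∈ C.support),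
    hC.filter_mem_support, Finset.prod_image]
  intro i hi j hj h
  exact hC.getVert_inj (Finset.mem_range.1 hi) (Finset.mem_range.1 hj) h

lemma SimpleGraph.Walk.IsCycle.card_filter_eq (hC : C.IsCycle) (p : Fin n → Prop)
    [DecidablePred p] : (Finset.univ.filter p).card
      = ((Finset.range C.length).filter fun i => p (C.getVert i)).card
        + (Finset.univ.filter fun v => v ∉ C.support ∧ p v).card := by
  -- In `Multiplicative ℕ` a count is a product, so the splitting of products applies.
  have h := hC.prod_eq (fun v => Multiplicative.ofAdd (if p v then 1 else 0 : ℕ))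
  rw [← ofAdd_sum, ← ofAdd_sum, ← ofAdd_sum, ← ofAdd_add] at h
  have h' := Multiplicative.ofAdd.injective h
  rw [← Finset.filter_filter, Finset.card_filter, Finset.card_filter, Finset.card_filter]
  exact h'

/-- The cyclic shift along a cycle, combined with an involution off the cycle. -/
noncomputable def SimpleGraph.Walk.IsCycle.shift (hC : C.IsCycle) {ρ : Fin n → Fin n}
    (hρ : Function.Involutive ρ) (hρC : ∀ v ∈ C.support, ρ v = v) : Equiv.Perm (Fin n) :=
  Equiv.ofBijective (C.glue (cyclicSucc C.length) ρ) (Finite.injective_iff_bijective.1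
    (hC.glue_injective (fun i hi => by unfold cyclicSucc; split_ifs <;> omega)
      (fun i hi j hj h => by unfold cyclicSucc at h; split_ifs at h <;> omega) hρ hρC))

lemma SimpleGraph.Walk.IsCycle.shift_getVert (hC : C.IsCycle) {ρ : Fin n → Fin n}
    (hρ : Function.Involutive ρ) (hρC : ∀ v ∈ C.support, ρ v = v) {i : ℕ} (hi : i < C.length) :
    hC.shift hρ hρC (C.getVert i) = C.getVert (i + 1) := by
  change C.glue _ ρ _ = _
  rw [hC.glue_getVert hi, getVert_cyclicSucc]

lemma SimpleGraph.Walk.IsCycle.shift_of_notMem (hC : C.IsCycle) {ρ : Fin n → Fin n}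
    (hρ : Function.Involutive ρ) (hρC : ∀ v ∈ C.support, ρ v = v) {v : Fin n}
    (hv : v ∉ C.support) : hC.shift hρ hρC v = ρ v := glue_of_notMem hv

lemma SimpleGraph.Walk.getVert_succ_ne {i : ℕ} (hi : i < C.length) :
    C.getVert (i + 1) ≠ C.getVert i := (C.adj_getVert_succ hi).ne'

end Glue

/-! ### Cycles with an odd number of negative edges. -/

namespace SignPattern

variable {n : ℕ} {P : SignPattern n} {u : Fin n} {C : P.graph.Walk u u} {ρ : Fin n → Fin n}

open SimpleGraph.Walk

lemma mul_ne_zero_iff_of_symm (hsymm : P.IsCombinatoriallySymmetric) (u v : Fin n) :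
    P u v * P v u ≠ 0 ↔ P u v ≠ 0 := by
  rw [mul_ne_zero_iff, ← hsymm u v, and_self]

lemma edgeSign_mk (a b : Fin n) : P.edgeSign s(a, b) = P a b * P b a := rfl

lemma SignType.list_prod_eq_neg_one_pow (l : List SignType) (h : ∀ s ∈ l, s ≠ 0) :
    l.prod = (-1) ^ l.countP (fun s => s = -1) := by
  induction l with
  | nil => simp
  | cons a l ih =>
    rw [List.prod_cons, ih fun s hs => h s (List.mem_cons_of_mem a hs)]
    have ha := h a List.mem_cons_self
    rw [List.countP_cons]
    rcases a.trichotomy with rfl | rfl | rfl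
    · simp [pow_succ]
    · exact absurd rfl ha
    · simp

/-- A cycle with an odd number of negative edges. -/
theorem not_requiresUniqueInertia_of_odd (hsymm : P.IsCombinatoriallySymmetric)
    (hdiag : P.HasZeroDiagonal) (hC : C.IsCycle) (hρ : Function.Involutive ρ)
    (hρC : ∀ v ∈ C.support, ρ v = v) (hρP : ∀ v, ρ v ≠ v → P v (ρ v) ≠ 0)
    (hX : ∀ A ∈ P.qualitativeClass,
      (X : ℝ[X]) ^ (Finset.univ.filter fun v => v ∉ C.support ∧ ρ v = v).card ∣ A.charpoly)
    (hodd : Odd (C.edges.countP (fun e => P.edgeSign e = -1))) :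
    ¬ P.RequiresUniqueInertia := by
  refine not_requiresUniqueInertia_of_perm hdiag (hC.shift hρ hρC) ?_ ?_
  · suffices h : (Finset.univ.filter fun v => hC.shift hρ hρC v = v).card
        = (Finset.univ.filter fun v => v ∉ C.support ∧ ρ v = v).card by rwa [h]
    rw [hC.card_filter_eq]
    have h1 : ((Finset.range C.length).filter fun i =>
        hC.shift hρ hρC (C.getVert i) = C.getVert i) = ∅ := by
      refine Finset.filter_eq_empty_iff.2 fun i hi => ?_
      rw [hC.shift_getVert hρ hρC (Finset.mem_range.1 hi)]
      exact C.getVert_succ_ne (Finset.mem_range.1 hi)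
    rw [h1, Finset.card_empty, zero_add]
    refine congrArg _ (Finset.filter_congr fun v _ => and_congr_right fun hv => ?_)
    rw [hC.shift_of_notMem hρ hρC hv]
  · rw [hC.prod_eq]
    -- The two vertices of a pair off the cycle contribute the same nonzero sign, and its square is
    -- 1.
    have h1 : ∏ v ∈ Finset.univ.filter (fun v => v ∉ C.support),
        (if hC.shift hρ hρC v = v then 1 else
          P v (hC.shift hρ hρC v) * P (hC.shift hρ hρC v) v) = 1 := by
      refine Finset.prod_involution (fun v _ => ρ v) ?_ ?_ ?_ ?_
      · intro v hv
        have hv := (Finset.mem_filter.1 hv).2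
        have hv' := notMem_support_of_involutive hρ hρC hv
        rw [hC.shift_of_notMem hρ hρC hv, hC.shift_of_notMem hρ hρC hv', hρ v]
        by_cases h : ρ v = v
        · rw [if_pos h, if_pos h.symm, one_mul]
        · rw [if_neg h, if_neg (Ne.symm h), mul_comm (P (ρ v) v)]
          have := (mul_ne_zero_iff_of_symm hsymm v (ρ v)).2 (hρP v h)
          revert this
          generalize P v (ρ v) * P (ρ v) v = s
          revert s
          decide
      · intro v hv h1 h2
        have hv := (Finset.mem_filter.1 hv).2
        rw [hC.shift_of_notMem hρ hρC hv, if_pos h2] at h1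
        exact h1 rfl
      · intro v hv
        have hv := (Finset.mem_filter.1 hv).2
        exact Finset.mem_filter.2 ⟨Finset.mem_univ _, notMem_support_of_involutive hρ hρC hv⟩
      · intro v _
        exact hρ v
    rw [h1, mul_one]
    have h2 : ∏ i ∈ Finset.range C.length,
        (if hC.shift hρ hρC (C.getVert i) = C.getVert i then 1 else
          P (C.getVert i) (hC.shift hρ hρC (C.getVert i))
            * P (hC.shift hρ hρC (C.getVert i)) (C.getVert i))
        = (C.edges.map P.edgeSign).prod := by
      rw [edges_eq_map_range, List.map_map, Finset.prod_range, ← List.prod_ofFn,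
        List.ofFn_eq_map, ← List.map_coe_finRange_eq_range, List.map_map]
      congr 1
      refine List.map_congr_left fun i _ => ?_
      rw [hC.shift_getVert hρ hρC i.2, if_neg (C.getVert_succ_ne i.2)]
      rfl
    rw [h2, SignType.list_prod_eq_neg_one_pow, List.countP_map]
    · exact hodd.neg_one_pow
    · intro s hs
      obtain ⟨e, he, rfl⟩ := List.mem_map.1 hs
      obtain ⟨a, b⟩ := e
      have := C.adj_of_mem_edges he
      exact (mul_ne_zero_iff_of_symm hsymm a b).2 ((graph_adj_iff hsymm hdiag).1 this)

end SignPattern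

namespace SignPattern

variable {n : ℕ} {P : SignPattern n} {u : Fin n} {C : P.graph.Walk u u} {ρ : Fin n → Fin n}

open SimpleGraph.Walk

/-! ### Matching bounds reduced to the cycle. -/

section Counting

/-- Off the cycle, every vertex is unmatched or belongs to a positive or a negative pair. -/
lemma card_off_cycle (hsymm : P.IsCombinatoriallySymmetric) (hdiag : P.HasZeroDiagonal)
    (hC : C.IsCycle) (hρP : ∀ v, ρ v ≠ v → P v (ρ v) ≠ 0) :
    (Finset.univ.filter fun v => v ∉ C.support ∧ P v (ρ v) * P (ρ v) v = 1).card
      + (Finset.univ.filter fun v => v ∉ C.support ∧ P v (ρ v) * P (ρ v) v = -1).card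
      + (Finset.univ.filter fun v => v ∉ C.support ∧ ρ v = v).card + C.length = n := by
  have h := hC.card_filter_eq (fun _ => True)
  simp only [Finset.filter_true, and_true, Finset.card_univ, Fintype.card_fin,
    Finset.card_range] at h
  have h2 : (Finset.univ.filter fun v => v ∉ C.support ∧ P v (ρ v) * P (ρ v) v = 1).card
      + (Finset.univ.filter fun v => v ∉ C.support ∧ P v (ρ v) * P (ρ v) v = -1).card
      + (Finset.univ.filter fun v => v ∉ C.support ∧ ρ v = v).card
      = (Finset.univ.filter fun v => v ∉ C.support).card := by
    simp only [Finset.card_filter, ← Finset.sum_add_distrib]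
    refine Finset.sum_congr rfl fun v _ => ?_
    by_cases hv : v ∈ C.support
    · simp [hv]
    · by_cases hf : ρ v = v
      · simp [hv, hf, hdiag v]
      · have := (mul_ne_zero_iff_of_symm hsymm v (ρ v)).2 (hρP v hf)
        simp only [hv, hf, not_false_eq_true, true_and, and_false, if_false]
        revert this
        generalize P v (ρ v) * P (ρ v) v = s
        revert s
        decide
  omega

variable {χ : Fin n → Bool}

lemma card_glue (hC : C.IsCycle) (t : ℕ → ℕ) (s : SignType) :
    (Finset.univ.filter fun v => P v (C.glue t ρ v) * P (C.glue t ρ v) v = s).card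
      = ((Finset.range C.length).filter fun i =>
          P.edgeSign s(C.getVert i, C.getVert (t i)) = s).card
        + (Finset.univ.filter fun v => v ∉ C.support ∧ P v (ρ v) * P (ρ v) v = s).card := by
  rw [hC.card_filter_eq]
  congr 2
  · refine Finset.filter_congr fun i hi => ?_
    rw [hC.glue_getVert (Finset.mem_range.1 hi), edgeSign_mk]
  · refine Finset.filter_congr fun v _ => and_congr_right fun hv => ?_
    rw [glue_of_notMem hv]

/-- A bound for the positive edges of one matching of the cycle and the negative edges of another
one. -/
theorem card_pos_add_card_neg_le_length (hsymm : P.IsCombinatoriallySymmetric)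
    (hdiag : P.HasZeroDiagonal) (hC : C.IsCycle) (hρ : Function.Involutive ρ)
    (hρC : ∀ v ∈ C.support, ρ v = v) (hρP : ∀ v, ρ v ≠ v → P v (ρ v) ≠ 0)
    (hX : ∀ A ∈ P.qualitativeClass,
      (X : ℝ[X]) ^ (Finset.univ.filter fun v => v ∉ C.support ∧ ρ v = v).card ∣ A.charpoly)
    (hχ : ∀ u v, χ u = χ v → P u v = 0) (hP : P.RequiresUniqueInertia) {t t' : ℕ → ℕ}
    (ht : ∀ i < C.length, t i < C.length ∧ t (t i) = i)
    (ht' : ∀ i < C.length, t' i < C.length ∧ t' (t' i) = i) :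
    ((Finset.range C.length).filter fun i =>
        P.edgeSign s(C.getVert i, C.getVert (t i)) = 1).card
      + ((Finset.range C.length).filter fun i =>
        P.edgeSign s(C.getVert i, C.getVert (t' i)) = -1).card ≤ C.length := by
  have h := P.card_pos_add_card_neg_le (hC.glue_involutive ht hρ hρC) hχ hP
    (hC.glue_involutive ht' hρ hρC) hX
  rw [card_glue hC, card_glue hC] at h
  have := card_off_cycle hsymm hdiag hC hρP
  omega

end Counting

/-! ### An additional eigenvalue from the directed cycle. -/

section DirectedCycle

/-- Magnitudes selecting the directed cycle and the pairs off the cycle. -/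
noncomputable def cycleWeight (C : P.graph.Walk u u) (ρ : Fin n → Fin n) (v w : Fin n) : ℝ :=
  if C.glue (cyclicSucc C.length) ρ v = w then
    -- The summand 1 raises the magnitude of every pair to at least 2, away from the eigenvalues of
    -- modulus one that the cycle produces.
    (if v ∈ C.support then 1 else pairWeight ρ v + 1) else 0

lemma cycleWeight_nonneg (v w : Fin n) : 0 ≤ cycleWeight C ρ v w := by
  unfold cycleWeight
  have : (0 : ℝ) < pairWeight ρ v := by exact_mod_cast pairWeight_pos ρ v
  split_ifs <;> linarith

lemma mem_eigenvalues_of_mulVec {A : Matrix (Fin n) (Fin n) ℝ} {z : ℂ} {x : Fin n → ℂ}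
    (hx : x ≠ 0) (h : (A.map (algebraMap ℝ ℂ)).mulVec x = z • x) : z ∈ eigenvalues A := by
  rw [eigenvalues, mem_roots (Matrix.charpoly_monic _).ne_zero, IsRoot, Matrix.eval_charpoly,
    ← Matrix.exists_mulVec_eq_zero_iff]
  refine ⟨x, hx, ?_⟩
  rw [Matrix.sub_mulVec, h, sub_eq_zero]
  ext i
  simp [Matrix.scalar_apply, Matrix.mulVec_diagonal]

lemma cycleWeight_mulVec (x : Fin n → ℂ) (v : Fin n) :
    ((P.weighted (cycleWeight C ρ)).map (algebraMap ℝ ℂ)).mulVec x v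
      = (if v ∈ C.support then 1 else (pairWeight ρ v : ℂ) + 1)
        * (P v (C.glue (cyclicSucc C.length) ρ v) : ℂ) * x (C.glue (cyclicSucc C.length) ρ v) := by
  rw [Matrix.mulVec, dotProduct, Finset.sum_eq_single (C.glue (cyclicSucc C.length) ρ v)]
  · rw [Matrix.map_apply, weighted_apply, cycleWeight, if_pos rfl]
    congr 1
    split_ifs <;> cases P v (C.glue (cyclicSucc C.length) ρ v) <;> simp
  · intro w _ hw
    rw [Matrix.map_apply, weighted_apply, cycleWeight, if_neg hw.symm]
    simp
  · simp

lemma pairWeight_add_one_mem_eigenvalues (hdiag : P.HasZeroDiagonal) (hC : C.IsCycle)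
    (hρ : Function.Involutive ρ) (hρC : ∀ v ∈ C.support, ρ v = v) {v : Fin n} (hv : v ∉ C.support)
    (hpos : P v (ρ v) * P (ρ v) v = 1) :
    ((pairWeight ρ v + 1 : ℤ) : ℂ) ∈ eigenvalues (P.weighted (cycleWeight C ρ)) := by
  have hv' := notMem_support_of_involutive hρ hρC hv
  refine mem_eigenvalues_of_mulVec
    -- Both entries of a positive pair equal the same sign `P v (ρ v)`, so the vector with entries 1
    -- and this sign on the pair is an eigenvector.
    (x := fun w => if w = v then 1 else if w = ρ v then (P v (ρ v) : ℂ) else 0)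
    (fun h => by simpa using congrFun h v) ?_
  have hPv : P (ρ v) v = P v (ρ v) ∧ ((P v (ρ v) : ℂ)) * (P v (ρ v) : ℂ) = 1 := by
    revert hpos
    generalize P v (ρ v) = a
    generalize P (ρ v) v = b
    intro h
    rcases a.trichotomy with rfl | rfl | rfl <;> rcases b.trichotomy with rfl | rfl | rfl <;>
      first | exact absurd h (by decide) | simp
  ext w
  rw [cycleWeight_mulVec, Pi.smul_apply, smul_eq_mul]
  by_cases hw : w ∈ C.support
  · obtain ⟨i, hi, rfl⟩ := exists_lt_getVert_eq_of_mem hC hw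
    rw [hC.glue_getVert hi]
    have h1 : ∀ j, C.getVert j ≠ v := fun j h => hv (h ▸ C.getVert_mem_support j)
    have h2 : ∀ j, C.getVert j ≠ ρ v := fun j h => hv' (h ▸ C.getVert_mem_support j)
    simp [h1, h2]
  · rw [glue_of_notMem hw, if_neg hw]
    by_cases h1 : w = v
    · subst h1
      by_cases h2 : ρ w = w
      · rw [h2, hdiag, zero_mul] at hpos
        exact absurd hpos (by decide)
      · rw [if_pos rfl, if_neg h2, if_pos rfl]
        push_cast
        linear_combination ((pairWeight ρ w : ℂ) + 1) * hPv.2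
    · rw [if_neg h1]
      by_cases h2 : w = ρ v
      · subst h2
        rw [hρ v, if_pos rfl, if_pos rfl, pairWeight_apply hρ, hPv.1]
        push_cast
        ring
      · have h3 : ρ w ≠ v := fun h => h2 (by rw [← h, hρ])
        have h4 : ρ w ≠ ρ v := fun h => h1 (hρ.injective h)
        rw [if_neg h2, if_neg h3, if_neg h4, mul_zero, mul_zero]

lemma mem_eigenvalues_of_pow_eq (hC : C.IsCycle) (hρ : Function.Involutive ρ)
    (hρC : ∀ v ∈ C.support, ρ v = v) {z : ℂ}
    (hne : ∀ i < C.length, P (C.getVert i) (C.getVert (i + 1)) ≠ 0)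
    (hz : z ^ C.length = ∏ i ∈ Finset.range C.length,
      (P (C.getVert i) (C.getVert (i + 1)) : ℂ)) :
    z ∈ eigenvalues (P.weighted (cycleWeight C ρ)) := by
  set q : ℕ → ℂ := fun i => (P (C.getVert i) (C.getVert (i + 1)) : ℂ) with hq
  have hqq : ∀ i < C.length, q i * q i = 1 := by
    intro i hi
    have := hne i hi
    simp only [hq]
    rcases (P (C.getVert i) (C.getVert (i + 1))).trichotomy with h | h | h
    · rw [h]; simp
    · exact absurd h this
    · rw [h]; simp
  have hprod : ∀ m ≤ C.length,
      (∏ i ∈ Finset.range m, q i) * (∏ i ∈ Finset.range m, q i) = 1 := by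
    intro m hm
    rw [← Finset.prod_mul_distrib]
    exact Finset.prod_eq_one fun i hi => hqq i (by have := Finset.mem_range.1 hi; omega)
  have h3 := hC.three_le_length
  -- The eigenvalue equation at position `i` reads `q i * x (i + 1) = z * x i`. As `q i` is its own
  -- inverse, this is a recursion along the cycle, and `hz` is the condition that it closes up.
  set x : Fin n → ℂ := fun w => if w ∈ C.support then
    z ^ C.cycleIndex w * ∏ i ∈ Finset.range (C.cycleIndex w), q i else 0 with hx
  have hxi : ∀ i < C.length, x (C.getVert i) = z ^ i * ∏ j ∈ Finset.range i, q j := by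
    intro i hi
    simp only [hx]
    rw [if_pos (C.getVert_mem_support i), hC.cycleIndex_getVert hi]
  refine mem_eigenvalues_of_mulVec (x := x) (fun h => ?_) ?_
  · have h1 := hxi 0 (by omega)
    rw [h] at h1
    simp at h1
  · ext w
    rw [cycleWeight_mulVec, Pi.smul_apply, smul_eq_mul]
    by_cases hw : w ∈ C.support
    · obtain ⟨i, hi, rfl⟩ := exists_lt_getVert_eq_of_mem hC hw
      rw [hC.glue_getVert hi, if_pos hw, one_mul, hxi i hi, getVert_cyclicSucc]
      change q i * _ = _
      by_cases hik : i + 1 = C.length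
      · have h4 : C.getVert (i + 1) = C.getVert 0 := by
          rw [hik, C.getVert_length, C.getVert_zero]
        rw [h4, hxi 0 (by omega), Finset.range_zero, Finset.prod_empty, pow_zero]
        rw [← hik, Finset.prod_range_succ, pow_succ] at hz
        have h5 := hprod i (by omega)
        linear_combination (-(∏ j ∈ Finset.range i, q j)) * hz - q i * h5
      · rw [hxi (i + 1) (by omega), Finset.prod_range_succ, pow_succ]
        linear_combination (z ^ i * z * ∏ j ∈ Finset.range i, q j) * hqq i hi
    · have hw' := notMem_support_of_involutive hρ hρC hw
      rw [glue_of_notMem hw]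
      simp only [hx, if_neg hw, if_neg hw', mul_zero]

/-- A number of modulus one with positive real part and given power `1` or `-1`. -/
lemma exists_pow_eq_of_three_le {k : ℕ} (hk : 3 ≤ k) {c : ℂ} (hc : c = 1 ∨ c = -1) :
    ∃ z : ℂ, z ^ k = c ∧ 0 < z.re ∧ ‖z‖ = 1 := by
  rcases hc with rfl | rfl
  · exact ⟨1, by simp, by simp, by simp⟩
  · have hk' : (3 : ℝ) ≤ k := by exact_mod_cast hk
    refine ⟨Complex.exp ((Real.pi / k : ℝ) * Complex.I), ?_, ?_, ?_⟩
    · rw [← Complex.exp_nat_mul, ← Complex.exp_pi_mul_I]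
      congr 1
      have : (k : ℂ) ≠ 0 := by exact_mod_cast (by omega : k ≠ 0)
      push_cast
      field_simp
    · rw [Complex.exp_ofReal_mul_I_re]
      have hpi := Real.pi_pos
      have h1 : 0 < Real.pi / k := by positivity
      have h2 : Real.pi / k < Real.pi / 2 := by
        apply div_lt_div_of_pos_left hpi (by norm_num) (by linarith)
      exact Real.cos_pos_of_mem_Ioo ⟨by linarith, h2⟩
    · exact Complex.norm_exp_ofReal_mul_I _

/-- Some matrix has more eigenvalues with positive real part than positive pairs off the cycle. -/
theorem exists_card_add_two_le (hdiag : P.HasZeroDiagonal) (hC : C.IsCycle)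
    (hρ : Function.Involutive ρ) (hρC : ∀ v ∈ C.support, ρ v = v)
    (hne : ∀ i < C.length, P (C.getVert i) (C.getVert (i + 1)) ≠ 0) :
    ∃ A ∈ P.qualitativeClass,
      (Finset.univ.filter fun v => v ∉ C.support ∧ P v (ρ v) * P (ρ v) v = 1).card + 2
        ≤ 2 * (inertia A).1 := by
  obtain ⟨A, hA, h⟩ := P.exists_countP_le (w := cycleWeight C ρ) cycleWeight_nonneg
    (fun z => 0 < z.re) (isOpen_lt continuous_const Complex.continuous_re)
  refine ⟨A, hA, ?_⟩
  set T := Finset.univ.filter fun v => v ∉ C.support ∧ P v (ρ v) * P (ρ v) v = 1 with hT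
  -- Only the two members of a pair share a weight, so `T` yields at least `T.card / 2` distinct
  -- positive eigenvalues; `z` adds one more.
  have hfib : T.card ≤ 2 * (T.image (pairWeight ρ)).card := by
    refine Finset.card_le_mul_card_image T 2 fun b hb => ?_
    obtain ⟨v, -, rfl⟩ := Finset.mem_image.1 hb
    refine (Finset.card_le_card (t := {v, ρ v}) fun w hw => ?_).trans Finset.card_le_two
    have := eq_or_eq_of_pairWeight_eq hρ (Finset.mem_filter.1 hw).2
    simpa using this
  obtain ⟨z, hz, hzre, hz1⟩ := exists_pow_eq_of_three_le hC.three_le_length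
    (c := ∏ i ∈ Finset.range C.length, (P (C.getVert i) (C.getVert (i + 1)) : ℂ)) (by
      refine Finset.prod_induction _ (fun c : ℂ => c = 1 ∨ c = -1) ?_ (Or.inl rfl) ?_
      · rintro a b (rfl | rfl) (rfl | rfl) <;> simp
      · intro i hi
        have := hne i (Finset.mem_range.1 hi)
        rcases (P (C.getVert i) (C.getVert (i + 1))).trichotomy with h | h | h
        · rw [h]; simp
        · exact absurd h this
        · rw [h]; simp)
  have hcast : Function.Injective fun m : ℤ => ((m + 1 : ℤ) : ℂ) := fun a b hab => by
    have := Int.cast_injective hab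
    omega
  set F : Finset ℂ := (T.image (pairWeight ρ)).image fun m : ℤ => ((m + 1 : ℤ) : ℂ) with hF
  have hFmem : ∀ y ∈ F, ∃ v ∈ T, y = ((pairWeight ρ v + 1 : ℤ) : ℂ) := by
    intro y hy
    obtain ⟨m, hm, rfl⟩ := Finset.mem_image.1 hy
    obtain ⟨v, hv, rfl⟩ := Finset.mem_image.1 hm
    exact ⟨v, hv, rfl⟩
  have hzF : z ∉ F := by
    intro hzF
    obtain ⟨v, -, hv⟩ := hFmem z hzF
    rw [hv, Complex.norm_intCast] at hz1
    have h1 := pairWeight_pos ρ v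
    have h2 : |pairWeight ρ v + 1| = 1 := by exact_mod_cast hz1
    rw [abs_of_pos (by omega)] at h2
    omega
  have hle : (insert z F).val ≤ eigenvalues (P.weighted (cycleWeight C ρ)) := by
    refine (Multiset.le_iff_subset (insert z F).nodup).2 fun y hy => ?_
    rcases Finset.mem_insert.1 (Finset.mem_def.2 hy) with rfl | hy
    · exact mem_eigenvalues_of_pow_eq hC hρ hρC hne hz
    · obtain ⟨v, hv, rfl⟩ := hFmem y hy
      have hv := (Finset.mem_filter.1 hv).2
      exact pairWeight_add_one_mem_eigenvalues hdiag hC hρ hρC hv.1 hv.2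
  have h1 := Multiset.countP_le_of_le (fun z : ℂ => 0 < z.re) hle
  have h2 : (insert z F).val.countP (fun z : ℂ => 0 < z.re) = (T.image (pairWeight ρ)).card + 1 := by
    rw [Multiset.countP_eq_card.2, Finset.card_val, Finset.card_insert_of_notMem hzF,
      Finset.card_image_of_injective _ hcast]
    intro y hy
    rcases Finset.mem_insert.1 (Finset.mem_def.2 hy) with rfl | hy
    · exact hzre
    · obtain ⟨v, hv, rfl⟩ := hFmem y hy
      have := pairWeight_pos ρ v
      rw [Complex.intCast_re]
      exact_mod_cast (by omega : 0 < pairWeight ρ v + 1)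
  unfold inertia
  dsimp only
  omega

end DirectedCycle

/-! ### Even cycles: all edges negative, or a maximal signed path of odd length. -/

section EvenCycle

/-- The perfect matching of an even cycle that contains the first edge. -/
def evenMatching (i : ℕ) : ℕ := if Even i then i + 1 else i - 1

/-- The perfect matching of an even cycle of length `k` that contains the last edge. -/
def oddMatching (k i : ℕ) : ℕ :=
  if i = 0 then k - 1 else if i = k - 1 then 0 else if Even i then i - 1 else i + 1

/-- The matching that follows `evenMatching` up to position `l` and `oddMatching` after it. -/
def pathMatching (k l i : ℕ) : ℕ :=
  if i ≤ l then evenMatching i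
  -- Positions `l + 1` and `k - 1` are fixed because their partners `l` and `0` under `oddMatching`
  -- belong to the path. If `l = k - 1`, no position reaches this branch.
  else if i = l + 1 ∨ i = k - 1 then i else oddMatching k i

lemma evenMatching_spec {k : ℕ} (hk : Even k) : ∀ i < k,
    evenMatching i < k ∧ evenMatching (evenMatching i) = i := by
  intro i hi
  unfold evenMatching
  grind

lemma oddMatching_spec {k : ℕ} (hk : Even k) : ∀ i < k,
    oddMatching k i < k ∧ oddMatching k (oddMatching k i) = i := by
  intro i hi
  unfold oddMatching
  grind

lemma pathMatching_spec {k l : ℕ} (hk : Even k) (hl : Odd l) (hlk : l < k) : ∀ i < k,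
    pathMatching k l i < k ∧ pathMatching k l (pathMatching k l i) = i := by
  intro i hi
  unfold pathMatching oddMatching evenMatching
  grind

lemma edgeSign_evenMatching (i : ℕ) : P.edgeSign s(C.getVert i, C.getVert (evenMatching i))
    = P.edgeSign s(C.getVert (if Even i then i else i - 1),
        C.getVert ((if Even i then i else i - 1) + 1)) := by
  unfold evenMatching
  split_ifs with h
  · rfl
  · have : i - 1 + 1 = i := by
      have : i ≠ 0 := by rintro rfl; simp at h
      omega
    rw [this, Sym2.eq_swap]

/-- An even cycle with only negative edges. -/
theorem not_requiresUniqueInertia_of_forall_neg (hsymm : P.IsCombinatoriallySymmetric)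
    (hdiag : P.HasZeroDiagonal) (hC : C.IsCycle) (hρ : Function.Involutive ρ)
    (hρC : ∀ v ∈ C.support, ρ v = v) (hρP : ∀ v, ρ v ≠ v → P v (ρ v) ≠ 0)
    (hX : ∀ A ∈ P.qualitativeClass,
      (X : ℝ[X]) ^ (Finset.univ.filter fun v => v ∉ C.support ∧ ρ v = v).card ∣ A.charpoly)
    {χ : Fin n → Bool} (hχ : ∀ u v, χ u = χ v → P u v = 0) (heven : Even C.length)
    (hneg : ∀ i < C.length, P.edgeSign s(C.getVert i, C.getVert (i + 1)) = -1) :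
    ¬ P.RequiresUniqueInertia := by
  intro hP
  -- With `p` vertices in positive pairs and `q` in negative pairs off the cycle, the three counts
  -- are at least `p / 2 + 1`, `p / 2` and `C.length + q + m`. Their sum is `n + 1`.
  obtain ⟨A, hA, h1⟩ := exists_card_add_two_le hdiag hC hρ hρC
    (fun i hi => (graph_adj_iff hsymm hdiag).1 (C.adj_getVert_succ hi))
  obtain ⟨B, hB, h2⟩ := P.exists_card_pos_le_two_mul_neg
    (hC.glue_involutive (t := id) (fun i hi => ⟨hi, rfl⟩) hρ hρC) hχ
  obtain ⟨D, hD, h3⟩ := P.exists_card_neg_add_le_zero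
    (hC.glue_involutive (evenMatching_spec heven) hρ hρC) hχ hX
  rw [card_glue hC] at h2 h3
  rw [hP B hB A hA] at h2
  rw [hP D hD A hA] at h3
  have h4 : ((Finset.range C.length).filter fun i =>
      P.edgeSign s(C.getVert i, C.getVert (evenMatching i)) = -1).card = C.length := by
    rw [Finset.filter_true_of_mem, Finset.card_range]
    intro i hi
    have hi := Finset.mem_range.1 hi
    rw [edgeSign_evenMatching]
    exact hneg _ (by split_ifs <;> omega)
  have h5 := card_off_cycle hsymm hdiag hC hρP
  have h6 := inertia_sum A
  omega

/-- The position of the edge of `oddMatching k` at position `i`. -/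
def oddEdge (k i : ℕ) : ℕ :=
  if i = 0 then k - 1 else if Even i ∧ i ≠ k - 1 then i - 1 else i

lemma oddEdge_lt {k i : ℕ} (hi : i < k) : oddEdge k i < k := by
  unfold oddEdge
  split_ifs <;> omega

/-- At the ends of the path and at the positions next to them, `oddMatching` uses the two edges that
bound the path; these have the opposite sign. -/
lemma oddEdge_of_boundary {k l i : ℕ} (hl : Odd l)
    (h : i = 0 ∨ i = l ∨ i = l + 1 ∨ i = k - 1) : oddEdge k i = k - 1 ∨ oddEdge k i = l := by
  unfold oddEdge
  grind

lemma edgeSign_oddMatching {i : ℕ} (hi : i < C.length) :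
    P.edgeSign s(C.getVert i, C.getVert (oddMatching C.length i))
    = P.edgeSign s(C.getVert (oddEdge C.length i), C.getVert (oddEdge C.length i + 1)) := by
  have hk : C.getVert (C.length - 1 + 1) = C.getVert 0 := by
    rw [Nat.sub_add_cancel (by omega), C.getVert_length, C.getVert_zero]
  unfold oddMatching oddEdge
  by_cases h0 : i = 0
  · rw [if_pos h0, if_pos h0, hk, h0, Sym2.eq_swap]
  · rw [if_neg h0, if_neg h0]
    by_cases h1 : i = C.length - 1
    · rw [if_pos h1, if_neg (fun h => h.2 h1), h1, hk]
    · rw [if_neg h1]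
      by_cases h2 : Even i
      · rw [if_pos h2, if_pos ⟨h2, h1⟩, Nat.sub_add_cancel (by omega), Sym2.eq_swap]
      · rw [if_neg h2, if_neg (fun h => h2 h.1)]

/-- An even cycle that begins with a maximal signed path of odd length `l`. -/
theorem not_requiresUniqueInertia_of_odd_path (hsymm : P.IsCombinatoriallySymmetric)
    (hdiag : P.HasZeroDiagonal) (hC : C.IsCycle) (hρ : Function.Involutive ρ)
    (hρC : ∀ v ∈ C.support, ρ v = v) (hρP : ∀ v, ρ v ≠ v → P v (ρ v) ≠ 0)
    (hX : ∀ A ∈ P.qualitativeClass,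
      (X : ℝ[X]) ^ (Finset.univ.filter fun v => v ∉ C.support ∧ ρ v = v).card ∣ A.charpoly)
    {χ : Fin n → Bool} (hχ : ∀ u v, χ u = χ v → P u v = 0) (heven : Even C.length)
    {l : ℕ} (hl : Odd l) (hlk : l < C.length) {s : SignType} (hs : s ≠ 0)
    (hpath : ∀ i < l, P.edgeSign s(C.getVert i, C.getVert (i + 1)) = s)
    (hnext : P.edgeSign s(C.getVert l, C.getVert (l + 1)) = -s)
    (hprev : P.edgeSign s(C.getVert (C.length - 1), C.getVert (C.length - 1 + 1)) = -s) :
    ¬ P.RequiresUniqueInertia := by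
  intro hP
  set g : ℕ → SignType := fun i => P.edgeSign s(C.getVert i, C.getVert (i + 1)) with hg
  have hg0 : ∀ i < C.length, g i = s ∨ g i = -s := by
    intro i hi
    have h1 : g i ≠ 0 := (mul_ne_zero_iff_of_symm hsymm _ _).2
      ((graph_adj_iff hsymm hdiag).1 (C.adj_getVert_succ hi))
    have h2 : ∀ a b : SignType, a ≠ 0 → b ≠ 0 → a = b ∨ a = -b := by decide
    exact h2 _ _ h1 hs
  -- Every position is counted at least once: on the path by `pathMatching`, next to it by
  -- `oddMatching`, and elsewhere by the edge common to both matchings, whose sign is `s` or `-s`.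
  -- The ends `0` and `l` of the path are counted twice.
  have hlt : C.length + 2 ≤ ((Finset.range C.length).filter fun i =>
      P.edgeSign s(C.getVert i, C.getVert (pathMatching C.length l i)) = s).card
        + ((Finset.range C.length).filter fun i =>
      P.edgeSign s(C.getVert i, C.getVert (oddMatching C.length i)) = -s).card := by
    have ha : ∀ i ≤ l,
        P.edgeSign s(C.getVert i, C.getVert (pathMatching C.length l i)) = s := by
      intro i hi
      rw [pathMatching, if_pos hi, edgeSign_evenMatching]
      refine hpath _ ?_
      clear * - hi hl
      grind
    have hb : ∀ i < C.length, i = 0 ∨ i = l ∨ i = l + 1 ∨ i = C.length - 1 →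
        P.edgeSign s(C.getVert i, C.getVert (oddMatching C.length i)) = -s := by
      intro i hi h
      rw [edgeSign_oddMatching hi]
      rcases oddEdge_of_boundary hl h with h | h <;> rw [h]
      exacts [hprev, hnext]
    have hab : ∀ i < C.length, l < i → i ≠ l + 1 → i ≠ C.length - 1 →
        P.edgeSign s(C.getVert i, C.getVert (pathMatching C.length l i)) = s ∨
        P.edgeSign s(C.getVert i, C.getVert (oddMatching C.length i)) = -s := by
      intro i hi h1 h2 h3
      rw [pathMatching, if_neg (by omega), if_neg (by omega), edgeSign_oddMatching hi]
      exact hg0 _ (oddEdge_lt hi)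
    simp only [Finset.card_filter, ← Finset.sum_add_distrib]
    have hsum : C.length + 2 = ∑ i ∈ Finset.range C.length,
        (1 + ((if i = 0 then 1 else 0) + if i = l then 1 else 0)) := by
      rw [Finset.sum_add_distrib, Finset.sum_add_distrib, Finset.sum_ite_eq', Finset.sum_ite_eq',
        if_pos (Finset.mem_range.2 hlk), if_pos (Finset.mem_range.2 (by omega))]
      simp
    rw [hsum]
    refine Finset.sum_le_sum fun i hi => ?_
    have hi := Finset.mem_range.1 hi
    have hl0 : l ≠ 0 := by rintro rfl; simp at hl
    by_cases hil : i ≤ l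
    · rw [if_pos (ha i hil)]
      by_cases h : i = 0 ∨ i = l
      · rw [if_pos (hb i hi (by omega))]
        split_ifs <;> omega
      · rw [if_neg (by omega), if_neg (by omega)]
        omega
    · rw [if_neg (show i ≠ 0 by omega), if_neg (show i ≠ l by omega)]
      by_cases h : i = l + 1 ∨ i = C.length - 1
      · rw [if_pos (hb i hi (by omega))]
        omega
      · rcases hab i hi (by omega) (by omega) (by omega) with h | h
        · rw [if_pos h]; omega
        · rw [if_pos h]; omega
  have h1 := pathMatching_spec heven hl hlk
  have h2 := oddMatching_spec heven
  -- The bound takes positive edges from one matching and negative edges from the other, so `s`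
  -- decides their order.
  rcases s.trichotomy with rfl | rfl | rfl
  · have := card_pos_add_card_neg_le_length hsymm hdiag hC hρ hρC hρP hX hχ hP h2 h1
    rw [neg_neg] at hlt
    omega
  · exact hs rfl
  · have := card_pos_add_card_neg_le_length hsymm hdiag hC hρ hρC hρP hX hχ hP h1 h2
    omega

end EvenCycle

end SignPattern

namespace SignPattern

open SimpleGraph.Walk

/-! ### Aligning the cycle with a given path. -/

section Normalization

variable {V : Type*} {G : SimpleGraph V} {x y : V} {C : G.Walk x x} {Q : G.Walk x y}

/-- A path whose edges lie on a cycle follows the cycle if its first step does. -/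
lemma getVert_eq_of_path (hC : C.IsCycle) (hQ : Q.IsPath)
    (hQC : ∀ e ∈ Q.edges, e ∈ C.edges) (h1 : Q.getVert 1 = C.getVert 1) :
    ∀ j ≤ Q.length, j < C.length ∧ Q.getVert j = C.getVert j := by
  have h3 := hC.three_le_length
  have hstep : ∀ j, j + 1 ≤ Q.length → Q.getVert j = C.getVert j → j < C.length →
      (1 ≤ j → Q.getVert (j - 1) = C.getVert (j - 1)) →
      j + 1 < C.length ∧ Q.getVert (j + 1) = C.getVert (j + 1) := by
    intro j hj hjeq hjlt hprev
    have hnext : Q.getVert (j + 1) = C.getVert (j + 1) := by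
      by_cases h0 : j = 0
      · rw [h0]; exact h1
      -- At this vertex the cycle offers only the next edge and the previous one. The previous one
      -- would bring the path back to its vertex at `j - 1`.
      have hmem := hQC s(Q.getVert j, Q.getVert (j + 1)) ((mk_mem_edges_iff_exists Q).2
        ⟨j, by omega, rfl⟩)
      obtain ⟨i, hi, he⟩ := (mk_mem_edges_iff_exists C).1 hmem
      rw [Sym2.eq_iff, hjeq] at he
      rcases he with ⟨h4, h5⟩ | ⟨h4, h5⟩
      · rw [← h5, hC.getVert_inj hi hjlt h4]
      · rw [← getVert_cyclicSucc] at h5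
        have h6 := hC.getVert_inj (by unfold cyclicSucc; split_ifs <;> omega) hjlt h5
        have h7 : i = j - 1 := by
          unfold cyclicSucc at h6
          split_ifs at h6 <;> omega
        rw [h7, ← hprev (by omega)] at h4
        have := hQ.getVert_injOn (show j - 1 ≤ Q.length by omega) (show j + 1 ≤ Q.length by omega) h4
        omega
    refine ⟨?_, hnext⟩
    by_contra hlt
    have h4 : j + 1 = C.length := by omega
    rw [h4, C.getVert_length, ← h4] at hnext
    replace hnext := hnext.trans Q.getVert_zero.symm
    have := hQ.getVert_injOn (show j + 1 ≤ Q.length by omega) (show 0 ≤ Q.length by omega) hnext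
    omega
  intro j
  induction j using Nat.strong_induction_on with
  | _ j ih =>
  intro hj
  rcases j with _ | j
  · exact ⟨by omega, by rw [Q.getVert_zero, C.getVert_zero]⟩
  · obtain ⟨h4, h5⟩ := ih j (by omega) (by omega)
    refine hstep j hj h5 h4 fun h => (ih (j - 1) (by omega) (by omega)).2

/-- A cycle can be rotated and reflected such that it begins with a given path. -/
lemma exists_cycle_getVert_eq [DecidableEq V] {u : V} {C : G.Walk u u} (hC : C.IsCycle)
    (hQ : Q.IsPath) (hQ0 : 0 < Q.length) (hQC : ∀ e ∈ Q.edges, e ∈ C.edges) :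
    ∃ C' : G.Walk x x, C'.IsCycle ∧ C'.length = C.length ∧ (∀ e, e ∈ C'.edges ↔ e ∈ C.edges) ∧
      (∀ v, v ∈ C'.support ↔ v ∈ C.support) ∧
      ∀ j ≤ Q.length, j < C'.length ∧ Q.getVert j = C'.getVert j := by
  have hmem : s(Q.getVert 0, Q.getVert 1) ∈ C.edges :=
    hQC _ ((mk_mem_edges_iff_exists Q).2 ⟨0, hQ0, rfl⟩)
  rw [Q.getVert_zero] at hmem
  have hx : x ∈ C.support := C.fst_mem_support_of_mem_edges hmem
  set R := C.rotate x hx with hR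
  have hRC : R.IsCycle := hC.rotate hx
  have hRe : ∀ e, e ∈ R.edges ↔ e ∈ C.edges := fun e => (C.rotate_edges x hx).perm.mem_iff
  have hRs : ∀ v, v ∈ R.support ↔ v ∈ C.support := fun v => C.mem_support_rotate_iff x hx
  have hRl : R.length = C.length := C.length_rotate x hx
  obtain ⟨i, hi, he⟩ := (mk_mem_edges_iff_exists R).1 ((hRe _).2 hmem)
  have h3 := hRC.three_le_length
  rw [Sym2.eq_iff] at he
  -- The first edge of `Q` is the first or the last edge of the rotated cycle; in the second case
  -- the cycle is reversed.
  rcases he with ⟨h4, h5⟩ | ⟨h4, h5⟩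
  · have h6 : i = 0 := hRC.getVert_inj hi (by omega) (h4.trans R.getVert_zero.symm)
    subst h6
    exact ⟨R, hRC, hRl, hRe, hRs, getVert_eq_of_path hRC hQ
      (fun e he => (hRe e).2 (hQC e he)) h5.symm⟩
  · rw [← getVert_cyclicSucc] at h5
    have h6 := hRC.getVert_inj (by unfold cyclicSucc; split_ifs <;> omega)
      (show 0 < R.length by omega) (h5.trans R.getVert_zero.symm)
    have h7 : i = R.length - 1 := by
      unfold cyclicSucc at h6
      split_ifs at h6; omega
    refine ⟨R.reverse, hRC.reverse, by rw [length_reverse, hRl], fun e => ?_, fun v => ?_,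
      getVert_eq_of_path hRC.reverse hQ (fun e he => ?_) ?_⟩
    · rw [edges_reverse, List.mem_reverse, hRe]
    · rw [support_reverse, List.mem_reverse, hRs]
    · rw [edges_reverse, List.mem_reverse, hRe]
      exact hQC e he
    · rw [getVert_reverse, ← h4, h7]

end Normalization

end SignPattern

open SignPattern SimpleGraph.Walk

theorem theorem3p8 (n : ℕ) (P : SignPattern n) (hirr : P.IsIrreducible)
    (hsymm : P.IsCombinatoriallySymmetric) (hdiag : P.HasZeroDiagonal)
    (u : Fin n) (C : P.graph.Walk u u) (hC : P.IsUniqueCycle C)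
    (hleaf : ∀ v, P.IsLeaf v → Even (P.distToCycle C v))
    (h : Odd (C.edges.countP (fun e => P.edgeSign e = -1)) ∨
      (∀ e ∈ C.edges, P.edgeSign e = -1) ∨
      (Even C.length ∧ ∃ (s : SignType) (x y : Fin n) (Q : P.graph.Walk x y),
        P.IsMaximalSignedPath C s Q ∧ Odd Q.length)) :
    ¬ P.RequiresUniqueInertia := by
  have hconn := graph_connected hirr hsymm hdiag u
  obtain ⟨ρ, hρ, hρC, hρP, hX⟩ := exists_tree_matching hconn hsymm hdiag hC hleaf
  rcases h with hodd | hneg | ⟨heven, s, x, y, Q, ⟨hs, hQ, hQ0, hQC, hQe⟩, hQodd⟩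
  · exact not_requiresUniqueInertia_of_odd hsymm hdiag hC.1 hρ hρC hρP hX hodd
  · rcases Nat.even_or_odd C.length with heven | hodd
    · obtain ⟨χ, hχ⟩ := exists_bipartition hsymm hdiag hC heven
      exact not_requiresUniqueInertia_of_forall_neg hsymm hdiag hC.1 hρ hρC hρP hX hχ heven
        fun i hi => hneg _ ((mk_mem_edges_iff_exists C).2 ⟨i, hi, rfl⟩)
    · refine not_requiresUniqueInertia_of_odd hsymm hdiag hC.1 hρ hρC hρP hX ?_
      rwa [List.countP_eq_length.2 (by simpa using hneg), C.length_edges]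
  · obtain ⟨χ, hχ⟩ := exists_bipartition hsymm hdiag hC heven
    obtain ⟨R, hR, hRl, hRe, hRs, hRQ⟩ :=
      exists_cycle_getVert_eq hC.1 hQ hQ0 fun e he => (hQC e he).1
    have hfilter : (Finset.univ.filter fun v => v ∉ C.support ∧ ρ v = v)
        = Finset.univ.filter fun v => v ∉ R.support ∧ ρ v = v :=
      Finset.filter_congr fun v _ => by rw [hRs]
    rw [hfilter] at hX
    have hedge : ∀ i < R.length, s(R.getVert i, R.getVert (i + 1)) ∈ C.edges := fun i hi =>
      (hRe _).1 ((mk_mem_edges_iff_exists R).2 ⟨i, hi, rfl⟩)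
    -- Maximality speaks only of edges outside `Q`. This makes it applicable to the edge after the
    -- path and to the last edge of `R`, which may coincide.
    have hnodup : ∀ i < R.length, Q.length ≤ i →
        s(R.getVert i, R.getVert (i + 1)) ∉ Q.edges := by
      intro i hi hQi hmem
      obtain ⟨j, hj, he⟩ := (mk_mem_edges_iff_exists Q).1 hmem
      rw [(hRQ j (by omega)).2, (hRQ (j + 1) (by omega)).2, ← getVert_cyclicSucc i] at he
      have h3 := hR.three_le_length
      have hj1 := (hRQ (j + 1) (by omega)).1
      have hsucc : cyclicSucc R.length i < R.length := by unfold cyclicSucc; split_ifs <;> omega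
      rw [Sym2.eq_iff] at he
      rcases he with ⟨h4, -⟩ | ⟨h4, h5⟩
      · have := hR.getVert_inj (by omega) hi h4
        omega
      · have h6 := hR.getVert_inj (by omega) hsucc h4
        have h7 := hR.getVert_inj (by omega) hi h5
        unfold cyclicSucc at h6
        split_ifs at h6 <;> omega
    have hlast : R.getVert (R.length - 1 + 1) = x := by
      rw [Nat.sub_add_cancel (by have := hR.three_le_length; omega), R.getVert_length]
    have hlt := (hRQ Q.length le_rfl).1
    refine not_requiresUniqueInertia_of_odd_path hsymm hdiag hR hρ
      (fun v hv => hρC v ((hRs v).1 hv)) hρP hX hχ (hRl ▸ heven) hQodd hlt hs ?_ ?_ ?_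
    · intro i hi
      rw [← (hRQ i hi.le).2, ← (hRQ (i + 1) hi).2]
      exact (hQC _ ((mk_mem_edges_iff_exists Q).2 ⟨i, hi, rfl⟩)).2
    · refine hQe _ (hedge _ hlt) (hnodup _ hlt le_rfl) (Or.inr ?_)
      rw [← (hRQ Q.length le_rfl).2, Q.getVert_length]
      exact Sym2.mem_mk_left _ _
    · refine hQe _ (hedge _ (by omega)) (hnodup _ (by omega) (by omega)) (Or.inl ?_)
      rw [hlast]
      exact Sym2.mem_mk_right _ _
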